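/- Let $T\in(0,\infty)$, let $(\Omega,\mathcal F,\mathbb P)$ be a probability space carrying a standard Wiener process $W=(W_t)_{t\in[0,T]}$ such that $\mathcal F$ is generated by $W$ up to $\mathbb P$-null sets, and let $I:L^2([0,T])\to L^2(\Omega)$ be the Wiener–Itô integral, i.e. the linear isometry with $I(\mathbf 1_{(0,t]})=W_t$. Let $C_b^\infty(\mathbb R^n)$ be the space of smooth functions on $\mathbb R^n$ that are bounded together with all their partial derivatives, and let $\mathcal S_b$ be the set of random variables $\Phi=f(I(h_1),\dots,I(h_n))$ with $n\in\mathbb N$, $f\in C_b^\infty(\mathbb R^n)$ and $h_1,\dots,h_n\in L^2([0,T])$. For such $\Phi$ and $k\ge 0$ put $$D^k\Phi=\sum_{i_1,\dots,i_k=1}^n(\partial^k_{i_1,\dots,i_k}f)(I(h_1),\dots,I(h_n))\,h_{i_1}\otimes\cdots\otimes h_{i_k},\qquad D^0\Phi=\Phi .$$ For $k\ge 0$, $\operatorname{Dom}\delta^k$ is the set of $v\in L^2(\Omega;L^2([0,T]^k))$ for which there is $c\in(0,\infty)$ with $|\langle D^k\Phi,v\rangle_{L^2(\Omega;L^2([0,T]^k))}|\le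 c\,\|\Phi\|_{L^2(\Omega)}$ for all $\Phi\in\mathcal S_b$, and, for $v\in\operatorname{Dom}\delta^k$, $\delta^k(v)$ is the unique element of $L^2(\Omega)$ with $\langle\Phi,\delta^k(v)\rangle_{L^2(\Omega)}=\langle v,D^k\Phi\rangle_{L^2(\Omega;L^2([0,T]^k))}$ for all $\Phi\in\mathcal S_b$. Here $L^2([0,T]^0)=\mathbb R$, so that $\delta^0$ is the identity on $L^2(\Omega)$. Let $k\ge 0$, let $F=f(I(h_1),\dots,I(h_n))$ with $f\in C_b^\infty(\mathbb R^n)$ and $h_1,\dots,h_n\in C([0,T])$, and let $u\in L^2([0,T]^k)$ be symmetric in all its variables. Then $Fu\in\operatorname{Dom}\delta^k$; for every $\ell\in\{0,\dots,k\}$ one has $u(\bullet,x)\in\operatorname{Dom}\delta^{k-\ell}$ for almost every $x\in[0,T]^\ell$, and the function $x\mapsto (D^\ell F)(x)\,\delta^{k-\ell}(u(\bullet,x))$ from $[0,T]^\ell$ to $L^2(\Omega)$ is Bochner integrable; and $$\delta^k(Fu)=\sum_{\ell=0}^k(-1)^\ell\binom k\ell\int_{[0,T]^\ell}(D^\ell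 F)(x)\,\delta^{k-\ell}(u(\bullet,x))\,dx\qquad\text{in }L^2(\Omega).$$ -/

import Mathlib

open MeasureTheory ProbabilityTheory Set
open scoped ENNReal NNReal

noncomputable section

namespace Malliavin

/-! ### The time interval, Lebesgue measure on it, and on its powers -/

/-- The time interval `[0, T]`. -/
abbrev Time (T : ℝ) : Type := Set.Icc (0 : ℝ) T

/-- Lebesgue measure on `[0, T]`. -/
def timeMeasure (T : ℝ) : Measure (Time T) :=
  (volume : Measure ℝ).comap Subtype.val

/-- Lebesgue measure on `[0, T]^k`. For `k = 0` this is the unit mass on the one-point space, so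
that `L²([0, T]^0)` is `ℝ`. -/
def cubeMeasure (T : ℝ) (k : ℕ) : Measure (Fin k → Time T) :=
  Measure.pi fun _ => timeMeasure T

instance isFiniteMeasure_timeMeasure (T : ℝ) : IsFiniteMeasure (timeMeasure T) := by
  refine ⟨?_⟩
  rw [timeMeasure, comap_subtype_coe_apply measurableSet_Icc, Set.image_univ,
    Subtype.range_coe_subtype]
  exact measure_Icc_lt_top

instance isFiniteMeasure_cubeMeasure (T : ℝ) (k : ℕ) : IsFiniteMeasure (cubeMeasure T k) := by
  unfold cubeMeasure
  infer_instance

/-- The interval `(0, t]` as a subset of `[0, T]`. -/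
def initialInterval {T : ℝ} (t : Time T) : Set (Time T) :=
  {s | 0 < (s : ℝ) ∧ s ≤ t}

theorem measurableSet_initialInterval {T : ℝ} (t : Time T) :
    MeasurableSet (initialInterval t) :=
  (measurableSet_lt measurable_const measurable_subtype_coe).inter measurableSet_Iic

theorem initialInterval_ae_eq {T : ℝ} (t : Time T) :
    initialInterval t =ᵐ[timeMeasure T] Set.Iic t := by
  have h0 : timeMeasure T {s : Time T | (s : ℝ) = 0} = 0 := by
    rw [timeMeasure, comap_subtype_coe_apply measurableSet_Icc]
    have h1 : Subtype.val '' {s : Time T | (s : ℝ) = 0} ⊆ {(0 : ℝ)} := by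
      rintro _ ⟨s, hs, rfl⟩
      exact hs
    exact le_antisymm ((measure_mono h1).trans (Real.volume_singleton (a := 0)).le) zero_le
  have h1 : ∀ᵐ s : Time T ∂(timeMeasure T), (s : ℝ) ≠ 0 := by
    rw [ae_iff]
    simpa using h0
  filter_upwards [h1] with s hs
  have h2 : 0 < (s : ℝ) := lt_of_le_of_ne s.2.1 (Ne.symm hs)
  apply propext
  change (0 < (s : ℝ) ∧ s ≤ t) ↔ s ≤ t
  simp [h2]

theorem timeMeasure_initialInterval_inter {T : ℝ} (s t : Time T) :
    (timeMeasure T).real (initialInterval s ∩ initialInterval t) = min (s : ℝ) t := by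
  have : Subtype.val '' (initialInterval s ∩ initialInterval t)
      = Set.Ioc (0 : ℝ) (min (s : ℝ) t) := by
    ext r
    simp only [initialInterval, Set.mem_image, Set.mem_inter_iff, Set.mem_ofPred_eq, Set.mem_Ioc,
      le_min_iff]
    constructor
    · rintro ⟨a, ⟨⟨h1, h2⟩, -, h3⟩, rfl⟩
      exact ⟨h1, h2, h3⟩
    · rintro ⟨h1, h2, h3⟩
      exact ⟨⟨r, h1.le, h2.trans s.2.2⟩, ⟨⟨h1, h2⟩, h1, h3⟩, rfl⟩
  rw [measureReal_def, timeMeasure, comap_subtype_coe_apply measurableSet_Icc, this,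
    Real.volume_Ioc, sub_zero, ENNReal.toReal_ofReal (le_min s.2.1 t.2.1)]

/-- The indicator function of `(0, t]` as an element of `L²([0, T])`. -/
def stepIndicator {T : ℝ} (t : Time T) : Lp ℝ 2 (timeMeasure T) :=
  indicatorConstLp 2 (measurableSet_initialInterval t) (measure_ne_top _ _) (1 : ℝ)

/-! ### The Wiener process and the Wiener-Itô integral -/

/-- `W` is a standard Wiener process on `[0, T]` under `P`. -/
structure IsWiener {Ω : Type*} [MeasurableSpace Ω] (T : ℝ) (W : Time T → Ω → ℝ)
    (P : Measure Ω) : Prop where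
  measurable : ∀ t, Measurable (W t)
  zero : ∀ t : Time T, (t : ℝ) = 0 → ∀ᵐ ω ∂P, W t ω = 0
  indep : HasIndepIncrements W P
  gaussian : ∀ s t : Time T, s ≤ t →
    HasLaw (fun ω => W t ω - W s ω) (gaussianReal 0 (Real.toNNReal ((t : ℝ) - s))) P
  continuous : ∀ᵐ ω ∂P, Continuous fun t => W t ω

/-- The `σ`-algebra of the probability space is generated by `W`, up to null sets: every event
agrees almost surely with an event of the `σ`-algebra generated by `W`. -/
def IsGeneratedBy {Ω : Type*} [MeasurableSpace Ω] {T : ℝ} (W : Time T → Ω → ℝ)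
    (P : Measure Ω) : Prop :=
  ∀ A : Set Ω, MeasurableSet A →
    ∃ B : Set Ω, MeasurableSet[⨆ t, MeasurableSpace.comap (W t) inferInstance] B ∧ A =ᵐ[P] B

section

variable {Ω : Type*} [MeasurableSpace Ω] {P : Measure Ω} {T : ℝ} {W : Time T → Ω → ℝ}

theorem integral_sq_of_hasLaw {X : Ω → ℝ} {v : ℝ≥0} (h : HasLaw X (gaussianReal 0 v) P) :
    ∫ ω, X ω ^ 2 ∂P = v := by
  have h1 : ∫ x, x ^ 2 ∂(gaussianReal 0 v) = v := by
    have h2 := variance_id_gaussianReal (μ := 0) (v := v)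
    rw [variance_of_integral_eq_zero aemeasurable_id (by simp)] at h2
    simpa using h2
  rw [← h1, ← h.map_eq, integral_map h.aemeasurable (by fun_prop)]

theorem memLp_two_of_hasLaw {X : Ω → ℝ} {v : ℝ≥0} (h : HasLaw X (gaussianReal 0 v) P) :
    MemLp X 2 P := by
  have h1 := memLp_id_gaussianReal (μ := 0) (v := v) 2
  rw [← h.map_eq] at h1
  exact (memLp_map_measure_iff (by fun_prop) h.aemeasurable).1 h1

theorem IsWiener.hasLaw_eval (hW : IsWiener T W P) (t : Time T) :
    HasLaw (W t) (gaussianReal 0 (Real.toNNReal t)) P := by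
  have h0 : (0 : ℝ) ≤ T := t.2.1.trans t.2.2
  have h := hW.gaussian ⟨0, le_rfl, h0⟩ t t.2.1
  have h1 : (fun ω => W t ω - W ⟨0, le_rfl, h0⟩ ω) =ᵐ[P] W t := by
    filter_upwards [hW.zero ⟨0, le_rfl, h0⟩ rfl] with ω hω
    simp [hω]
  simp only [sub_zero] at h
  exact h.congr h1.symm

theorem IsWiener.memLp (hW : IsWiener T W P) (t : Time T) : MemLp (W t) 2 P :=
  memLp_two_of_hasLaw (hW.hasLaw_eval t)

/-- `W_t` as an element of `L²(Ω)`. -/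
def IsWiener.toL2 (hW : IsWiener T W P) (t : Time T) : Lp ℝ 2 P :=
  (hW.memLp t).toLp (W t)

/-- The Wiener-Itô integral `L²([0, T]) → L²(Ω)`: the continuous linear extension of the map
`∑ᵢ aᵢ 1_{(0, tᵢ]} ↦ ∑ᵢ aᵢ W_{tᵢ}` on step functions. -/
def wienerIntegral (hW : IsWiener T W P) : Lp ℝ 2 (timeMeasure T) →L[ℝ] Lp ℝ 2 P :=
  LinearMap.extendOfNorm (Finsupp.linearCombination ℝ hW.toL2)
    (Finsupp.linearCombination ℝ (stepIndicator (T := T)))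

theorem inner_stepIndicator (s t : Time T) :
    inner ℝ (stepIndicator s) (stepIndicator t) = min (s : ℝ) t := by
  rw [stepIndicator, stepIndicator, L2.inner_indicatorConstLp_indicatorConstLp,
    Set.inter_comm, timeMeasure_initialInterval_inter]
  simp [min_comm]

theorem IsWiener.inner_toL2 (hW : IsWiener T W P) (s t : Time T) :
    inner ℝ (hW.toL2 s) (hW.toL2 t) = min (s : ℝ) t := by
  wlog hst : s ≤ t generalizing s t
  · rw [real_inner_comm, this t s (le_of_not_ge hst), min_comm]
  have hi : inner ℝ (hW.toL2 s) (hW.toL2 t) = ∫ ω, W t ω * W s ω ∂P := by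
    rw [L2.inner_def]
    refine integral_congr_ae ?_
    filter_upwards [(hW.memLp s).coeFn_toLp, (hW.memLp t).coeFn_toLp] with ω h1 h2
    simp only [IsWiener.toL2, h1, h2, RCLike.inner_apply, conj_trivial]
  have e1 := integral_sq_of_hasLaw (hW.hasLaw_eval s)
  have e2 := integral_sq_of_hasLaw (hW.hasLaw_eval t)
  have e3 := integral_sq_of_hasLaw (hW.gaussian s t hst)
  rw [Real.coe_toNNReal _ s.2.1] at e1
  rw [Real.coe_toNNReal _ t.2.1] at e2
  rw [Real.coe_toNNReal _ (sub_nonneg.2 hst)] at e3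
  have i1 := (hW.memLp s).integrable_sq
  have i2 := (hW.memLp t).integrable_sq
  have i3 := (memLp_two_of_hasLaw (hW.gaussian s t hst)).integrable_sq
  have e4 : ∫ ω, W t ω * W s ω ∂P
      = ∫ ω, (1 / 2 : ℝ) * ((W s ω ^ 2 + W t ω ^ 2) - (W t ω - W s ω) ^ 2) ∂P := by
    congr 1
    ext ω
    ring
  have e5 := integral_sub (i1.add i2) i3
  simp only [Pi.add_apply] at e5
  rw [hi, e4, integral_const_mul, e5, integral_add i1 i2, e1, e2, e3,
    min_eq_left (show (s : ℝ) ≤ t from hst)]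
  ring

theorem IsWiener.norm_linearCombination (hW : IsWiener T W P) (a : Time T →₀ ℝ) :
    ‖Finsupp.linearCombination ℝ hW.toL2 a‖
      = ‖Finsupp.linearCombination ℝ (stepIndicator (T := T)) a‖ := by
  have : inner ℝ (Finsupp.linearCombination ℝ hW.toL2 a) (Finsupp.linearCombination ℝ hW.toL2 a)
      = inner ℝ (Finsupp.linearCombination ℝ (stepIndicator (T := T)) a)
        (Finsupp.linearCombination ℝ (stepIndicator (T := T)) a) := by
    simp only [Finsupp.linearCombination_apply, Finsupp.sum, sum_inner, inner_sum,
      real_inner_smul_left, real_inner_smul_right, hW.inner_toL2, inner_stepIndicator]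
  rw [real_inner_self_eq_norm_sq, real_inner_self_eq_norm_sq] at this
  exact (sq_eq_sq₀ (norm_nonneg _) (norm_nonneg _)).1 this

theorem denseRange_stepIndicator (hT : 0 < T) :
    DenseRange (Finsupp.linearCombination ℝ (stepIndicator (T := T))) := by
  have hspan : (Submodule.span ℝ (Set.range (stepIndicator (T := T)))).topologicalClosure = ⊤ := by
    rw [Submodule.topologicalClosure_eq_top_iff, Submodule.eq_bot_iff]
    intro f hf
    have hint : Integrable f (timeMeasure T) := (Lp.memLp f).integrable (by norm_num)
    have h1 : ∀ t : Time T, ∫ x in Set.Iic t, f x ∂(timeMeasure T) = 0 := by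
      intro t
      have h2 := (Submodule.mem_orthogonal _ _).1 hf _
        (Submodule.subset_span (Set.mem_range_self t))
      rw [stepIndicator, L2.inner_indicatorConstLp_one] at h2
      exact (setIntegral_congr_set (initialInterval_ae_eq t).symm).trans h2
    have huniv : ∫ x, f x ∂(timeMeasure T) = 0 := by
      have h2 : Set.Iic (⟨T, hT.le, le_rfl⟩ : Time T) = Set.univ :=
        Set.eq_univ_of_forall fun s => s.2.2
      have h3 := h1 ⟨T, hT.le, le_rfl⟩
      rwa [h2, setIntegral_univ] at h3
    have h3 : ∀ s : Set (Time T), MeasurableSet s → ∫ x in s, f x ∂(timeMeasure T) = 0 := by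
      intro s hs
      have hgen : (inferInstance : MeasurableSpace (Time T))
          = MeasurableSpace.generateFrom (Set.range Set.Iic) := by
        rw [← borel_eq_generateFrom_Iic]
        exact BorelSpace.measurable_eq
      induction s, hs using MeasurableSpace.induction_on_inter hgen isPiSystem_Iic with
      | empty => simp
      | basic t ht =>
        obtain ⟨a, rfl⟩ := ht
        exact h1 a
      | compl t ht ih =>
        rw [setIntegral_compl ht hint, ih, huniv, sub_zero]
      | iUnion g hd hm ih =>
        rw [integral_iUnion hm hd hint.integrableOn]
        simp [ih]
    have h4 := Lp.ae_eq_zero_of_forall_setIntegral_eq_zero f two_ne_zero ENNReal.ofNat_ne_top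
      (fun s _ _ => hint.integrableOn) (fun s hs _ => h3 s hs)
    exact (Lp.eq_zero_iff_ae_eq_zero).2 h4
  rw [DenseRange, ← LinearMap.coe_range, Finsupp.range_linearCombination]
  exact (Submodule.dense_iff_topologicalClosure_eq_top).2 hspan

theorem wienerIntegral_stepIndicator (hT : 0 < T) (hW : IsWiener T W P) (t : Time T) :
    wienerIntegral hW (stepIndicator t) = hW.toL2 t := by
  have h := LinearMap.extendOfNorm_eq (f := Finsupp.linearCombination ℝ hW.toL2)
    (denseRange_stepIndicator hT)
    ⟨1, fun a => by rw [one_mul, hW.norm_linearCombination]⟩ (Finsupp.single t 1)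
  simpa [wienerIntegral] using h

theorem norm_wienerIntegral (hT : 0 < T) (hW : IsWiener T W P) (h : Lp ℝ 2 (timeMeasure T)) :
    ‖wienerIntegral hW h‖ = ‖h‖ := by
  refine (denseRange_stepIndicator hT).induction_on h
    (isClosed_eq (by fun_prop) (by fun_prop)) fun a => ?_
  rw [wienerIntegral, LinearMap.extendOfNorm_eq (denseRange_stepIndicator hT)
    ⟨1, fun a => by rw [one_mul, hW.norm_linearCombination]⟩, hW.norm_linearCombination]

end

/-! ### Smooth bounded random variables and their Malliavin derivatives -/

/-- `∂^k f / ∂x_{i 1} ⋯ ∂x_{i k}` for `f : ℝⁿ → ℝ`. -/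
def partialDeriv {n k : ℕ} (f : (Fin n → ℝ) → ℝ) (i : Fin k → Fin n) (y : Fin n → ℝ) : ℝ :=
  iteratedFDeriv ℝ k f y fun j => Pi.single (i j) 1

/-- The space `C_b^∞(ℝⁿ)`: `f` is infinitely differentiable, and `f` and all its partial
derivatives are bounded. -/
def IsCbInfty {n : ℕ} (f : (Fin n → ℝ) → ℝ) : Prop :=
  ContDiff ℝ (⊤ : ℕ∞) f ∧ ∀ (k : ℕ) (i : Fin k → Fin n), ∃ C : ℝ, ∀ y, |partialDeriv f i y| ≤ C

/-- The data of a smooth bounded random variable `f(I(h₁), …, I(hₙ))` with `f ∈ C_b^∞(ℝⁿ)` and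
`h₁, …, hₙ ∈ L²([0, T])`. -/
structure SmoothVar (T : ℝ) where
  n : ℕ
  f : (Fin n → ℝ) → ℝ
  smooth : IsCbInfty f
  h : Fin n → Time T → ℝ
  memLp : ∀ i, MemLp (h i) 2 (timeMeasure T)

section

variable {Ω : Type*} [MeasurableSpace Ω] {P : Measure Ω} {T : ℝ} {W : Time T → Ω → ℝ}

/-- The random vector `(I(h₁), …, I(hₙ))`. -/
def SmoothVar.vec (F : SmoothVar T) (hW : IsWiener T W P) (ω : Ω) : Fin F.n → ℝ :=
  fun i => wienerIntegral hW ((F.memLp i).toLp (F.h i)) ω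

/-- The random variable `F = f(I(h₁), …, I(hₙ))`. -/
def SmoothVar.val (F : SmoothVar T) (hW : IsWiener T W P) (ω : Ω) : ℝ :=
  F.f (F.vec hW ω)

/-- The `k`-th Malliavin derivative
`D^k F = ∑ (∂^k_{i₁, …, i_k} f)(I(h₁), …, I(hₙ)) h_{i₁} ⊗ ⋯ ⊗ h_{i_k}`, the sum being over all
`i₁, …, i_k ∈ {1, …, n}`. For `k = 0` it is `F`. -/
def SmoothVar.deriv (F : SmoothVar T) (hW : IsWiener T W P) (k : ℕ) (ω : Ω)
    (x : Fin k → Time T) : ℝ :=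
  ∑ i : Fin k → Fin F.n, partialDeriv F.f i (F.vec hW ω) * ∏ j, F.h (i j) (x j)

theorem SmoothVar.memLp_top_deriv (F : SmoothVar T) (hW : IsWiener T W P) (k : ℕ)
    (x : Fin k → Time T) : MemLp (fun ω => F.deriv hW k ω x) ∞ P := by
  unfold SmoothVar.deriv
  refine memLp_finsetSum _ fun i _ => ?_
  refine MemLp.mul_const ?_ _
  obtain ⟨C, hC⟩ := F.smooth.2 k i
  refine memLp_top_of_bound ?_ C (Filter.Eventually.of_forall fun ω => hC _)
  have hc : Continuous (partialDeriv F.f i) := by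
    have h1 : Continuous (iteratedFDeriv ℝ k F.f) :=
      F.smooth.1.continuous_iteratedFDeriv (by exact_mod_cast le_top)
    unfold partialDeriv
    fun_prop
  have hv : AEMeasurable (F.vec hW) P :=
    aemeasurable_pi_lambda _ fun j => (Lp.aestronglyMeasurable _).aemeasurable
  exact (hc.measurable.comp_aemeasurable hv).aestronglyMeasurable

/-! ### The divergence operators -/

/-- The inner product `⟨v, D^k Φ⟩` in `L²(Ω; L²([0, T]^k))`, this space being identified with
`L²(Ω × [0, T]^k)`. -/
def pairing (hW : IsWiener T W P) {k : ℕ} (v : Ω → (Fin k → Time T) → ℝ) (Φ : SmoothVar T) : ℝ :=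
  ∫ z, v z.1 z.2 * Φ.deriv hW k z.1 z.2 ∂(P.prod (cubeMeasure T k))

/-- The domain of `δ^k`: square integrable processes `v` on `[0, T]^k` for which
`|⟨D^k Φ, v⟩| ≤ c ‖Φ‖_{L²(Ω)}` for all smooth bounded `Φ`. -/
def MemDomDivergence (hW : IsWiener T W P) {k : ℕ} (v : Ω → (Fin k → Time T) → ℝ) : Prop :=
  MemLp (fun z : Ω × (Fin k → Time T) => v z.1 z.2) 2 (P.prod (cubeMeasure T k)) ∧
    ∃ c : ℝ, 0 < c ∧ ∀ Φ : SmoothVar T,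
      |pairing hW v Φ| ≤ c * (eLpNorm (Φ.val hW) 2 P).toReal

/-- The defining relation of `G = δ^k(v)`: `⟨Φ, G⟩ = ⟨v, D^k Φ⟩` for all smooth bounded `Φ`. -/
def IsDivergence (hW : IsWiener T W P) {k : ℕ} (v : Ω → (Fin k → Time T) → ℝ)
    (G : Lp ℝ 2 P) : Prop :=
  ∀ Φ : SmoothVar T, ∫ ω, Φ.val hW ω * G ω ∂P = pairing hW v Φ

open Classical in
/-- The divergence operator `δ^k`, with values in `L²(Ω)`: for `v` in its domain, the element of
`L²(Ω)` with `⟨Φ, δ^k(v)⟩ = ⟨v, D^k Φ⟩` for all smooth bounded `Φ`; outside its domain, `0`. -/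
def divergence (hW : IsWiener T W P) {k : ℕ} (v : Ω → (Fin k → Time T) → ℝ) : Lp ℝ 2 P :=
  if h : MemDomDivergence hW v ∧ ∃ G : Lp ℝ 2 P, IsDivergence hW v G then h.2.choose else 0

/-! ### The terms of the expansion -/

/-- For `u` on `[0, T]^k`, `ℓ ≤ k` and `x ∈ [0, T]^ℓ`, the function `u(•, x)` on `[0, T]^{k-ℓ}`. -/
def sectionAt {k : ℕ} (u : (Fin k → Time T) → ℝ) (ℓ : Fin (k + 1)) (x : Fin ℓ → Time T)
    (y : Fin (k - ℓ) → Time T) : ℝ :=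
  u fun i => Fin.append y x (Fin.cast (Nat.sub_add_cancel (Nat.le_of_lt_succ ℓ.2)).symm i)

/-- The element `(D^ℓ F)(x) δ^{k-ℓ}(u(•, x))` of `L²(Ω)`. -/
def expansionTerm (hW : IsWiener T W P) {k : ℕ} (F : SmoothVar T) (u : (Fin k → Time T) → ℝ)
    (ℓ : Fin (k + 1)) (x : Fin ℓ → Time T) : Lp ℝ 2 P :=
  MemLp.toLp
    (fun ω => F.deriv hW ℓ ω x * divergence hW (fun _ : Ω => sectionAt u ℓ x) ω)
    (MemLp.mul' (Lp.memLp _) (F.memLp_top_deriv hW ℓ x))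

end

end Malliavin

end

/-!
The defining relation of `δ^k` is a duality with smooth bounded random variables `Φ`. Once `Φ` and
`F` are written as functions `f` and `g` of one common vector of Wiener-Itô integrals, it becomes a
statement about `f` and `g`. The pairing of `F u` with `D^k Φ` is the mean of `g ∂^k f`, contracted
with the coefficients `∫ u (h_{i_1} ⊗ ⋯ ⊗ h_{i_k})`. These are symmetric, and for symmetric
coefficients the Leibniz rule can be inverted (`sum_partialDeriv_mul_eq`):
`g ∂^k f = ∑_l (-1)^l (k choose l) ∂^{k-l} (f ∂^l g)`.
The term of index `l`, with the contraction split by Fubini's theorem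
into blocks of `k - l` and `l` variables, is the integral over `x` of the pairing of `u(•, x)` with
the `(k-l)`-th derivative of `Φ · (D^l F)(x)`, that is, of `E[Φ (D^l F)(x) δ^{k-l}(u(•, x))]`. Hence
the right-hand side of the expansion satisfies the relation that characterises `δ^k(F u)`
(`isDivergence_sum_expansionTerm`).

It remains to know that `δ^m` is defined on deterministic functions, and that it can be applied to
the sections of `u` in an integrable manner. Both follow from the fact that `δ^m` is a bounded
operator from `L²([0, T]^m)` to `L²(Ω)` (`exists_clm_isDivergence`), namely the adjoint of the
closure of `Φ ↦ E[D^m Φ]`. Boundedness of this map is a bound for the integrals of the `m`-th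
partial derivatives of a function with respect to the standard Gaussian measure by its `L²` norm,
with a constant independent of the dimension (`exists_abs_sum_integral_partialDeriv_le`); it is
proved by induction on `m`, by writing a Gaussian vector as `(Y + Z)/√2` and integrating by parts in
`Y` only. It applies since Wiener-Itô integrals of orthonormal functions form a standard Gaussian
vector (`map_wienerIntegral_of_orthonormal`). Uniqueness of the divergence, and the density of the
domain of `Φ ↦ E[D^m Φ]`, come from the totality of smooth bounded random variables in `L²(Ω)`
(`eq_zero_of_forall_integral_val_mul_eq_zero`), where the assumption that `W` generates the
σ-algebra enters. Finally, the sections of a square integrable function are Bochner integrable with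
values in `L²` (`exists_integrable_section`), since this space is separable.
-/

namespace Malliavin

/-! ### Functions bounded with all their partial derivatives -/

/-- A total derivative is determined by the partial derivatives, by multilinearity. -/
theorem iteratedFDeriv_apply_eq_sum {n k : ℕ} (f : (Fin n → ℝ) → ℝ) (y : Fin n → ℝ)
    (w : Fin k → Fin n → ℝ) :
    iteratedFDeriv ℝ k f y w = ∑ i : Fin k → Fin n, partialDeriv f i y * ∏ j, w j (i j) := by
  have hw : w = fun j => ∑ l : Fin n, w j l • (Pi.single l 1 : Fin n → ℝ) := by
    funext j
    exact pi_eq_sum_univ' (w j)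
  conv_lhs => rw [hw]
  rw [ContinuousMultilinearMap.map_sum]
  refine Finset.sum_congr rfl fun i _ => ?_
  rw [ContinuousMultilinearMap.map_smul_univ, smul_eq_mul, mul_comm, partialDeriv]

/-- Boundedness of all partial derivatives amounts to boundedness of the total derivatives. -/
theorem isCbInfty_iff {n : ℕ} {f : (Fin n → ℝ) → ℝ} :
    IsCbInfty f ↔ ContDiff ℝ (⊤ : ℕ∞) f ∧
      ∀ k : ℕ, ∃ C : ℝ, ∀ y, ‖iteratedFDeriv ℝ k f y‖ ≤ C := by
  refine ⟨fun h => ⟨h.1, fun k => ?_⟩, fun h => ⟨h.1, fun k i => ?_⟩⟩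
  · choose C hC using h.2 k
    have h0 : ∀ i, 0 ≤ C i := fun i => (abs_nonneg _).trans (hC i 0)
    refine ⟨∑ i, C i, fun y => ContinuousMultilinearMap.opNorm_le_bound
      (Finset.sum_nonneg fun i _ => h0 i) fun w => ?_⟩
    rw [iteratedFDeriv_apply_eq_sum, Finset.sum_mul]
    refine (norm_sum_le _ _).trans (Finset.sum_le_sum fun i _ => ?_)
    rw [norm_mul, norm_prod]
    exact mul_le_mul (hC i y)
      (Finset.prod_le_prod (fun _ _ => norm_nonneg _) fun j _ => norm_le_pi_norm (w j) (i j))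
      (Finset.prod_nonneg fun _ _ => norm_nonneg _) (h0 i)
  · obtain ⟨C, hC⟩ := h.2 k
    refine ⟨C, fun y => ?_⟩
    refine ((iteratedFDeriv ℝ k f y).le_opNorm _).trans ?_
    refine le_trans ?_ (hC y)
    refine mul_le_of_le_one_right (norm_nonneg _) (Finset.prod_le_one (fun _ _ => norm_nonneg _) ?_)
    intro j _
    rw [Pi.norm_single, norm_one]

theorem IsCbInfty.bounded {n : ℕ} {f : (Fin n → ℝ) → ℝ} (hf : IsCbInfty f) :
    ∃ C, ∀ y, |f y| ≤ C := by
  obtain ⟨C, hC⟩ := hf.2 0 Fin.elim0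
  exact ⟨C, fun y => by simpa [partialDeriv] using hC y⟩

theorem contDiff_partialDeriv {n k : ℕ} {f : (Fin n → ℝ) → ℝ}
    (hf : ContDiff ℝ (⊤ : ℕ∞) f) (i : Fin k → Fin n) :
    ContDiff ℝ (⊤ : ℕ∞) (partialDeriv f i) := by
  have h1 : ContDiff ℝ (⊤ : ℕ∞) (iteratedFDeriv ℝ k f) :=
    hf.iteratedFDeriv_right (by norm_cast)
  exact (ContinuousMultilinearMap.apply ℝ (fun _ : Fin k => Fin n → ℝ) ℝ
    fun j => Pi.single (i j) 1).contDiff.comp h1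

theorem partialDeriv_zero {n : ℕ} (f : (Fin n → ℝ) → ℝ) (i : Fin 0 → Fin n) :
    partialDeriv f i = f := by
  funext y
  simp [partialDeriv]

theorem partialDeriv_one {n : ℕ} (f : (Fin n → ℝ) → ℝ) (r : Fin n) (y : Fin n → ℝ) :
    partialDeriv f (fun _ : Fin 1 => r) y = fderiv ℝ f y (Pi.single r 1) := by
  simp [partialDeriv]

/-- The first index of a partial derivative belongs to the differentiation carried out last. -/
theorem partialDeriv_cons {n k : ℕ} {f : (Fin n → ℝ) → ℝ} (hf : ContDiff ℝ (⊤ : ℕ∞) f)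
    (r : Fin n) (i : Fin k → Fin n) :
    partialDeriv f (Fin.cons r i : Fin (k + 1) → Fin n)
      = partialDeriv (partialDeriv f i) fun _ : Fin 1 => r := by
  funext y
  have h1 : Differentiable ℝ (iteratedFDeriv ℝ k f) :=
    hf.differentiable_iteratedFDeriv (by exact_mod_cast ENat.natCast_lt_top k)
  rw [partialDeriv_one, partialDeriv, (h1 y).iteratedFDeriv_succ_apply_left']
  rfl

/-- The last index of a partial derivative belongs to the differentiation carried out first. -/
theorem partialDeriv_snoc {n k : ℕ} {f : (Fin n → ℝ) → ℝ} (hf : ContDiff ℝ (⊤ : ℕ∞) f)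
    (i : Fin k → Fin n) (r : Fin n) :
    partialDeriv f (Fin.snoc i r : Fin (k + 1) → Fin n)
      = partialDeriv (partialDeriv f fun _ : Fin 1 => r) i := by
  funext y
  have h2 : (partialDeriv f fun _ : Fin 1 => r) = fun y => fderiv ℝ f y (Pi.single r 1) := by
    funext y
    exact partialDeriv_one f r y
  have h3 : ContDiff ℝ (⊤ : ℕ∞) (fderiv ℝ f) := hf.fderiv_right (by simp)
  have h4 : (fun y => fderiv ℝ f y (Pi.single r 1))
      = (ContinuousLinearMap.apply ℝ ℝ (Pi.single r (1 : ℝ) : Fin n → ℝ)) ∘ fderiv ℝ f := rfl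
  rw [h2, partialDeriv, iteratedFDeriv_succ_apply_right, partialDeriv, h4,
    ContinuousLinearMap.iteratedFDeriv_comp_left _ h3.contDiffAt (by exact_mod_cast le_top)]
  have h5 : (Fin.init fun j => (Pi.single ((Fin.snoc i r : Fin (k + 1) → Fin n) j) 1 : Fin n → ℝ))
      = fun j => Pi.single (i j) 1 := by
    funext j
    simp [Fin.init]
  simp [h5]

theorem IsCbInfty.partialDeriv {n k : ℕ} {f : (Fin n → ℝ) → ℝ} (hf : IsCbInfty f)
    (i : Fin k → Fin n) : IsCbInfty (partialDeriv f i) := by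
  refine ⟨contDiff_partialDeriv hf.1 i, fun l j => ?_⟩
  -- A partial derivative of a partial derivative is a partial derivative.
  have key : ∀ (l : ℕ) (j : Fin l → Fin n), ∃ (m : ℕ) (i' : Fin m → Fin n),
      Malliavin.partialDeriv (Malliavin.partialDeriv f i) j = Malliavin.partialDeriv f i' := by
    intro l
    induction l with
    | zero => exact fun j => ⟨k, i, partialDeriv_zero _ _⟩
    | succ l ih =>
      intro j
      obtain ⟨m, i', h⟩ := ih (Fin.tail j)
      refine ⟨m + 1, Fin.cons (j 0) i', ?_⟩
      rw [partialDeriv_cons hf.1, ← h, ← partialDeriv_cons (contDiff_partialDeriv hf.1 i),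
        Fin.cons_self_tail]
  obtain ⟨m, i', h⟩ := key l j
  rw [h]
  exact hf.2 m i'

theorem IsCbInfty.comp_clm {n m : ℕ} {f : (Fin n → ℝ) → ℝ} (hf : IsCbInfty f)
    (A : (Fin m → ℝ) →L[ℝ] (Fin n → ℝ)) : IsCbInfty fun y => f (A y) := by
  rw [isCbInfty_iff] at hf ⊢
  refine ⟨hf.1.comp A.contDiff, fun k => ?_⟩
  obtain ⟨C, hC⟩ := hf.2 k
  refine ⟨C * ∏ _j : Fin k, ‖A‖, fun y => ?_⟩
  have := A.iteratedFDeriv_comp_right hf.1 y (i := k) (by exact_mod_cast le_top)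
  change ‖iteratedFDeriv ℝ k (f ∘ A) y‖ ≤ _
  rw [this]
  exact (ContinuousMultilinearMap.norm_compContinuousLinearMap_le _ _).trans
    (mul_le_mul_of_nonneg_right (hC _) (by positivity))

theorem IsCbInfty.mul {n : ℕ} {f g : (Fin n → ℝ) → ℝ} (hf : IsCbInfty f) (hg : IsCbInfty g) :
    IsCbInfty fun y => f y * g y := by
  rw [isCbInfty_iff] at hf hg ⊢
  refine ⟨hf.1.mul hg.1, fun k => ?_⟩
  choose C hC using hf.2
  choose D hD using hg.2
  refine ⟨∑ i ∈ Finset.range (k + 1), (k.choose i : ℝ) * C i * D (k - i), fun y => ?_⟩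
  refine (norm_iteratedFDeriv_mul_le hf.1 hg.1 y (n := k) (by exact_mod_cast le_top)).trans ?_
  refine Finset.sum_le_sum fun i _ => ?_
  exact mul_le_mul (mul_le_mul_of_nonneg_left (hC _ _) (by positivity)) (hD _ _) (norm_nonneg _)
    (mul_nonneg (by positivity) ((norm_nonneg _).trans (hC i y)))

theorem IsCbInfty.add {n : ℕ} {f g : (Fin n → ℝ) → ℝ} (hf : IsCbInfty f) (hg : IsCbInfty g) :
    IsCbInfty fun y => f y + g y := by
  rw [isCbInfty_iff] at hf hg ⊢
  refine ⟨hf.1.add hg.1, fun k => ?_⟩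
  obtain ⟨C, hC⟩ := hf.2 k
  obtain ⟨D, hD⟩ := hg.2 k
  refine ⟨C + D, fun y => ?_⟩
  rw [fun_iteratedFDeriv_add_apply (hf.1.of_le (by exact_mod_cast le_top)).contDiffAt
    (hg.1.of_le (by exact_mod_cast le_top)).contDiffAt]
  exact (norm_add_le _ _).trans (add_le_add (hC y) (hD y))

theorem IsCbInfty.const_mul {n : ℕ} {f : (Fin n → ℝ) → ℝ} (hf : IsCbInfty f) (c : ℝ) :
    IsCbInfty fun y => c * f y := by
  rw [isCbInfty_iff] at hf ⊢
  refine ⟨contDiff_const.mul hf.1, fun k => ?_⟩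
  obtain ⟨C, hC⟩ := hf.2 k
  refine ⟨‖c‖ * C, fun y => ?_⟩
  have h := iteratedFDeriv_const_smul_apply' (𝕜 := ℝ) (i := k) (a := c) (f := f) (x := y)
    (hf.1.of_le (by exact_mod_cast le_top)).contDiffAt
  simp only [smul_eq_mul] at h
  rw [h, norm_smul]
  exact mul_le_mul_of_nonneg_left (hC y) (norm_nonneg _)

theorem isCbInfty_zero {n : ℕ} : IsCbInfty fun _ : Fin n → ℝ => (0 : ℝ) := by
  rw [isCbInfty_iff]
  refine ⟨contDiff_const, fun k => ⟨0, fun y => ?_⟩⟩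
  have : (fun _ : Fin n → ℝ => (0 : ℝ)) = 0 := rfl
  simp [this]

theorem IsCbInfty.sum {n : ℕ} {ι : Type*} (s : Finset ι) {f : ι → (Fin n → ℝ) → ℝ}
    (hf : ∀ i, IsCbInfty (f i)) : IsCbInfty fun y => ∑ i ∈ s, f i y := by
  classical
  induction s using Finset.induction_on with
  | empty => simpa using isCbInfty_zero
  | insert a s ha ih =>
    simp only [Finset.sum_insert ha]
    exact (hf a).add ih

/-- A smooth function of one real variable with bounded derivatives, seen as a function on `ℝ¹`. -/
theorem isCbInfty_of_iteratedDeriv {φ : ℝ → ℝ} (hφ : ContDiff ℝ (⊤ : ℕ∞) φ)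
    (hb : ∀ (n : ℕ) (x : ℝ), |iteratedDeriv n φ x| ≤ 1) :
    IsCbInfty fun y : Fin 1 → ℝ => φ (y 0) := by
  rw [isCbInfty_iff]
  let A : (Fin 1 → ℝ) →L[ℝ] ℝ := ContinuousLinearMap.proj 0
  refine ⟨hφ.comp A.contDiff, fun k => ⟨1 * ∏ _j : Fin k, ‖A‖, fun y => ?_⟩⟩
  have := A.iteratedFDeriv_comp_right hφ y (i := k) (by exact_mod_cast le_top)
  change ‖iteratedFDeriv ℝ k (φ ∘ A) y‖ ≤ _
  rw [this]
  refine (ContinuousMultilinearMap.norm_compContinuousLinearMap_le _ _).trans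
    (mul_le_mul_of_nonneg_right ?_ (by positivity))
  rw [norm_iteratedFDeriv_eq_norm_iteratedDeriv]
  exact hb k _

theorem partialDeriv_add {n k : ℕ} {f g : (Fin n → ℝ) → ℝ} (hf : ContDiff ℝ (⊤ : ℕ∞) f)
    (hg : ContDiff ℝ (⊤ : ℕ∞) g) (i : Fin k → Fin n) (y : Fin n → ℝ) :
    partialDeriv (fun z => f z + g z) i y = partialDeriv f i y + partialDeriv g i y := by
  rw [partialDeriv, fun_iteratedFDeriv_add_apply (hf.of_le (by exact_mod_cast le_top)).contDiffAt
    (hg.of_le (by exact_mod_cast le_top)).contDiffAt]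
  rfl

/-- The first index of a partial derivative belongs to the differentiation carried out last. -/
theorem partialDeriv_const_mul {n k : ℕ} {f : (Fin n → ℝ) → ℝ} (hf : ContDiff ℝ (⊤ : ℕ∞) f)
    (c : ℝ) (i : Fin k → Fin n) (y : Fin n → ℝ) :
    partialDeriv (fun z => c * f z) i y = c * partialDeriv f i y := by
  have h := iteratedFDeriv_const_smul_apply' (𝕜 := ℝ) (i := k) (a := c) (f := f) (x := y)
    (hf.of_le (by exact_mod_cast le_top)).contDiffAt
  simp only [smul_eq_mul] at h
  rw [partialDeriv, h]
  rfl

theorem partialDeriv_sum {n k : ℕ} {ι : Type*} (s : Finset ι) {f : ι → (Fin n → ℝ) → ℝ}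
    (hf : ∀ a, ContDiff ℝ (⊤ : ℕ∞) (f a)) (i : Fin k → Fin n) (y : Fin n → ℝ) :
    partialDeriv (fun z => ∑ a ∈ s, f a z) i y = ∑ a ∈ s, partialDeriv (f a) i y := by
  classical
  induction s using Finset.induction_on with
  | empty =>
    have : (fun _ : Fin n → ℝ => (0 : ℝ)) = 0 := rfl
    simp [partialDeriv, this]
  | insert a s ha ih =>
    simp only [Finset.sum_insert ha]
    rw [partialDeriv_add (hf a) (ContDiff.sum fun a _ => hf a), ih]

theorem partialDeriv_mul_one {n : ℕ} {f g : (Fin n → ℝ) → ℝ} (hf : ContDiff ℝ (⊤ : ℕ∞) f)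
    (hg : ContDiff ℝ (⊤ : ℕ∞) g) (r : Fin n) (y : Fin n → ℝ) :
    partialDeriv (fun z => f z * g z) (fun _ : Fin 1 => r) y
      = partialDeriv f (fun _ : Fin 1 => r) y * g y
        + f y * partialDeriv g (fun _ : Fin 1 => r) y := by
  have h1 := (hf.differentiable (by simp)) y
  have h2 := (hg.differentiable (by simp)) y
  rw [partialDeriv_one, partialDeriv_one, partialDeriv_one, fderiv_fun_mul h1 h2]
  simp
  ring

/-- The chain rule for an affine change of variables `z ↦ w + b z`. -/
theorem partialDeriv_comp_affine {n k : ℕ} {f : (Fin n → ℝ) → ℝ} (hf : ContDiff ℝ (⊤ : ℕ∞) f)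
    (w : Fin n → ℝ) (b : ℝ) (i : Fin k → Fin n) (y : Fin n → ℝ) :
    partialDeriv (fun z => f (w + b • z)) i y = b ^ k * partialDeriv f i (w + b • y) := by
  let A : (Fin n → ℝ) →L[ℝ] (Fin n → ℝ) := b • ContinuousLinearMap.id ℝ _
  have h1 := A.iteratedFDeriv_comp_right (f := fun z => f (w + z))
    (hf.comp (contDiff_const.add contDiff_id)) y (i := k) (by exact_mod_cast le_top)
  have h2 : (fun z => f (w + b • z)) = (fun z => f (w + z)) ∘ A := by
    funext z
    simp [A]
  rw [partialDeriv, h2, h1, iteratedFDeriv_comp_add_left]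
  simp only [ContinuousMultilinearMap.compContinuousLinearMap_apply, A,
    smul_apply, ContinuousLinearMap.id_apply]
  rw [ContinuousMultilinearMap.map_smul_univ]
  simp [partialDeriv]

theorem IsCbInfty.comp_affine {n : ℕ} {f : (Fin n → ℝ) → ℝ} (hf : IsCbInfty f)
    (w : Fin n → ℝ) (b : ℝ) : IsCbInfty fun z => f (w + b • z) := by
  refine ⟨hf.1.comp (contDiff_const.add (contDiff_id.const_smul b)), fun k i => ?_⟩
  obtain ⟨C, hC⟩ := hf.2 k i
  refine ⟨|b ^ k| * C, fun y => ?_⟩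
  rw [partialDeriv_comp_affine hf.1, abs_mul]
  exact mul_le_mul_of_nonneg_left (hC _) (abs_nonneg _)

/-! ### Inner products of square integrable functions -/

section

variable {α : Type*} [MeasurableSpace α] {μ : Measure α}

theorem norm_toLp_eq_sqrt {f : α → ℝ} (hf : MemLp f 2 μ) :
    ‖hf.toLp f‖ = √(∫ x, f x ^ 2 ∂μ) := by
  rw [eq_comm, Real.sqrt_eq_iff_mul_self_eq (integral_nonneg fun _ => sq_nonneg _) (norm_nonneg _),
    ← real_inner_self_eq_norm_mul_norm, L2.inner_def]
  refine integral_congr_ae ?_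
  filter_upwards [hf.coeFn_toLp] with x hx
  simp [hx, pow_two]

theorem inner_toLp {f g : α → ℝ} (hf : MemLp f 2 μ) (hg : MemLp g 2 μ) :
    inner ℝ (hf.toLp f) (hg.toLp g) = ∫ x, f x * g x ∂μ := by
  rw [L2.inner_def]
  refine integral_congr_ae ?_
  filter_upwards [hf.coeFn_toLp, hg.coeFn_toLp] with x h1 h2
  simp [h1, h2, mul_comm]

theorem abs_integral_mul_le {f g : α → ℝ} (hf : MemLp f 2 μ) (hg : MemLp g 2 μ) :
    |∫ x, f x * g x ∂μ| ≤ √(∫ x, f x ^ 2 ∂μ) * √(∫ x, g x ^ 2 ∂μ) := by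
  rw [← inner_toLp hf hg, ← norm_toLp_eq_sqrt hf, ← norm_toLp_eq_sqrt hg]
  exact abs_real_inner_le_norm _ _

theorem integral_comp_of_measurePreserving {β : Type*} [MeasurableSpace β] {ν : Measure β}
    {g : α → β} (hg : MeasurePreserving g μ ν) {f : β → ℝ} (hf : AEStronglyMeasurable f ν) :
    ∫ x, f (g x) ∂μ = ∫ y, f y ∂ν := by
  rw [← hg.map_eq] at hf ⊢
  exact (integral_map hg.aemeasurable hf).symm

end

/-! ### The standard Gaussian measure -/

/-- The standard Gaussian measure on `ℝᴺ`. -/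
noncomputable def standardGaussian (N : ℕ) : Measure (Fin N → ℝ) :=
  Measure.pi fun _ => gaussianReal 0 1

instance (N : ℕ) : IsProbabilityMeasure (standardGaussian N) := by
  unfold standardGaussian
  infer_instance

theorem charFunDual_standardGaussian {N : ℕ} (K : StrongDual ℝ (Fin N → ℝ)) :
    charFunDual (standardGaussian N) K
      = Complex.exp (-((∑ i, K (Pi.single i 1) ^ 2 : ℝ) : ℂ) / 2) := by
  rw [standardGaussian, charFunDual_pi]
  have h : ∀ i, charFunDual (gaussianReal 0 1)
      (K.comp (ContinuousLinearMap.single ℝ (fun _ => ℝ) i))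
      = Complex.exp (-((K (Pi.single i 1) ^ 2 : ℝ) : ℂ) / 2) := by
    intro i
    have h1 : ∀ x : ℝ, (K.comp (ContinuousLinearMap.single ℝ (fun _ : Fin N => ℝ) i)) x
        = K (Pi.single i 1) * x := by
      intro x
      have : (Pi.single i x : Fin N → ℝ) = x • Pi.single i 1 := by
        rw [← Pi.single_smul, smul_eq_mul, mul_one]
      simp [this, mul_comm]
    have h2 := charFun_gaussianReal (μ := 0) (v := 1) (K (Pi.single i 1))
    rw [charFun_apply_real] at h2
    rw [charFunDual_apply]
    simp only [h1]
    push_cast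
    rw [h2]
    congr 1
    push_cast
    ring
  rw [Finset.prod_congr rfl fun i _ => h i, ← Complex.exp_sum]
  congr 1
  push_cast
  rw [← Finset.sum_div, Finset.sum_neg_distrib]

/-- The sum `aY + bZ` of independent standard Gaussian vectors is standard Gaussian if
`a² + b² = 1`. -/
theorem measurePreserving_rotation {N : ℕ} {a b : ℝ} (hab : a ^ 2 + b ^ 2 = 1) :
    MeasurePreserving (fun p : (Fin N → ℝ) × (Fin N → ℝ) => a • p.1 + b • p.2)
      ((standardGaussian N).prod (standardGaussian N)) (standardGaussian N) := by
  let A : (Fin N → ℝ) × (Fin N → ℝ) →L[ℝ] (Fin N → ℝ) :=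
    a • ContinuousLinearMap.fst ℝ _ _ + b • ContinuousLinearMap.snd ℝ _ _
  refine ⟨by fun_prop, ?_⟩
  change Measure.map A _ = _
  have : IsProbabilityMeasure (((standardGaussian N).prod (standardGaussian N)).map A) :=
    Measure.isProbabilityMeasure_map A.continuous.aemeasurable
  refine Measure.ext_of_charFunDual ?_
  funext K
  rw [charFunDual_map, charFunDual_prod, charFunDual_standardGaussian,
    charFunDual_standardGaussian, charFunDual_standardGaussian, ← Complex.exp_add]
  congr 1
  have h1 : ∀ x, ((K.comp A).comp (ContinuousLinearMap.inl ℝ _ _)) x = a * K x := by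
    intro x
    simp [A]
  have h2 : ∀ x, ((K.comp A).comp (ContinuousLinearMap.inr ℝ _ _)) x = b * K x := by
    intro x
    simp [A]
  simp only [h1, h2, mul_pow, ← Finset.mul_sum]
  rw [← add_div, ← neg_add, ← Complex.ofReal_add, ← add_mul, hab, one_mul]

theorem integral_standardGaussian_eval_mul_eval {N : ℕ} (i j : Fin N) :
    ∫ y, y i * y j ∂(standardGaussian N) = if i = j then 1 else 0 := by
  have h0 : ∫ x, x ^ 2 ∂(gaussianReal 0 1) = 1 := by
    have h := integral_sq_of_hasLaw (P := gaussianReal 0 1) (X := id) (v := 1)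
      ⟨aemeasurable_id, Measure.map_id⟩
    simpa using h
  have h1 : ∀ y : Fin N → ℝ, y i * y j
      = ∏ l, ((if l = i then y l else 1) * (if l = j then y l else 1)) := by
    intro y
    rw [Finset.prod_mul_distrib]
    simp
  simp_rw [h1]
  rw [standardGaussian, integral_fintype_prod_eq_prod (𝕜 := ℝ)
    (f := fun l x => (if l = i then x else 1) * (if l = j then x else 1))]
  by_cases hij : i = j
  · subst hij
    rw [if_pos rfl]
    refine Finset.prod_eq_one fun l _ => ?_
    by_cases hl : l = i
    · simpa [hl, ← pow_two] using h0
    · simp [hl]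
  · rw [if_neg hij]
    refine Finset.prod_eq_zero (Finset.mem_univ i) ?_
    simp [hij]

theorem memLp_standardGaussian_eval {N : ℕ} (i : Fin N) :
    MemLp (fun y : Fin N → ℝ => y i) 2 (standardGaussian N) := by
  have h := memLp_id_gaussianReal (μ := 0) (v := 1) 2
  exact h.comp_measurePreserving (measurePreserving_eval (fun _ : Fin N => gaussianReal 0 1) i)

/-! ### A bound for Gaussian integrals of partial derivatives -/

/-- One-dimensional Gaussian integration by parts. -/
theorem integral_id_mul_gaussianReal {g g' : ℝ → ℝ} (hg : ∀ x, HasDerivAt g (g' x) x)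
    (hg' : Continuous g') {C C' : ℝ} (hC : ∀ x, |g x| ≤ C) (hC' : ∀ x, |g' x| ≤ C') :
    ∫ x, x * g x ∂(gaussianReal 0 1) = ∫ x, g' x ∂(gaussianReal 0 1) := by
  -- The density `φ` solves `φ' x = -x φ x`; integrate `g φ'` by parts over the line.
  rw [integral_gaussianReal_eq_integral_smul one_ne_zero,
    integral_gaussianReal_eq_integral_smul one_ne_zero]
  have hgc : Continuous g := continuous_iff_continuousAt.2 fun x => (hg x).continuousAt
  set φ := gaussianPDFReal 0 1 with hφ
  have hφ1 : ∀ x, φ x = (√(2 * Real.pi))⁻¹ * Real.exp (-(1 / 2) * x ^ 2) := by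
    intro x
    simp only [hφ, gaussianPDFReal, NNReal.coe_one, mul_one, sub_zero]
    congr 2
    ring
  have hφ2 : ∀ x, HasDerivAt φ (-(x * φ x)) x := by
    intro x
    have h1 : φ = fun x => (√(2 * Real.pi))⁻¹ * Real.exp (-(1 / 2) * x ^ 2) := funext hφ1
    rw [hφ1, h1]
    have h2 := ((((hasDerivAt_id x).pow 2).const_mul (-(1 / 2 : ℝ))).exp).const_mul
      ((√(2 * Real.pi))⁻¹)
    refine h2.congr_deriv ?_
    simp
    ring
  have hφi : Integrable φ := integrable_gaussianPDFReal 0 1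
  have hφi2 : Integrable fun x => x * φ x := by
    have h := (integrable_mul_exp_neg_mul_sq (b := 1 / 2) (by norm_num)).const_mul
      ((√(2 * Real.pi))⁻¹)
    refine h.congr (Filter.Eventually.of_forall fun x => ?_)
    simp only [hφ1]
    ring
  have h := integral_mul_deriv_eq_deriv_mul_of_integrable (u := g) (v := φ) (u' := g')
    (v' := fun x => -(x * φ x)) (fun x _ => hg x) (fun x _ => hφ2 x)
    (hφi2.neg.bdd_mul (c := C) hgc.aestronglyMeasurable (Filter.Eventually.of_forall hC))
    (hφi.bdd_mul (c := C') hg'.aestronglyMeasurable (Filter.Eventually.of_forall hC'))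
    (hφi.bdd_mul (c := C) hgc.aestronglyMeasurable (Filter.Eventually.of_forall hC))
  have e1 : ∫ x, φ x • (x * g x) = -∫ x, g x * -(x * φ x) := by
    rw [← integral_neg]
    congr 1
    funext x
    simp only [smul_eq_mul]
    ring
  have e2 : ∫ x, φ x • g' x = ∫ x, g' x * φ x := by
    congr 1
    funext x
    simp only [smul_eq_mul]
    ring
  rw [e1, e2, h, neg_neg]

/-- Gaussian integration by parts on `ℝᴺ`. -/
theorem integral_eval_mul_standardGaussian {N : ℕ} {f : (Fin N → ℝ) → ℝ} (hf : IsCbInfty f)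
    (l : Fin N) :
    ∫ y, y l * f y ∂(standardGaussian N)
      = ∫ y, partialDeriv f (fun _ : Fin 1 => l) y ∂(standardGaussian N) := by
  obtain _ | N := N
  · exact l.elim0
  obtain ⟨C, hC⟩ := hf.bounded
  obtain ⟨C', hC'⟩ := hf.2 1 fun _ => l
  have hc1 : Continuous f := hf.1.continuous
  have hc2 := (contDiff_partialDeriv hf.1 (fun _ : Fin 1 => l)).continuous
  have hm := (measurePreserving_piFinSuccAbove
    (fun _ : Fin (N + 1) => gaussianReal 0 1) l).symm
  have hi1 : Integrable (fun y : Fin (N + 1) → ℝ => y l * f y) (standardGaussian (N + 1)) :=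
    ((memLp_standardGaussian_eval l).integrable (by norm_num)).mul_bdd (c := C)
      hc1.aestronglyMeasurable (Filter.Eventually.of_forall hC)
  have hi2 : Integrable (partialDeriv f fun _ : Fin 1 => l) (standardGaussian (N + 1)) :=
    Integrable.of_bound hc2.aestronglyMeasurable C' (Filter.Eventually.of_forall hC')
  have hi1' := hm.integrable_comp_of_integrable hi1
  have hi2' := hm.integrable_comp_of_integrable hi2
  unfold standardGaussian
  rw [← hm.integral_comp', ← hm.integral_comp']
  refine (integral_prod_symm _ hi1').trans (Eq.trans ?_ (integral_prod_symm _ hi2').symm)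
  simp only [Function.comp_apply]
  congr 1
  funext z
  have hins : ∀ x : ℝ, (MeasurableEquiv.piFinSuccAbove (fun _ : Fin (N + 1) => ℝ) l).symm (x, z)
      = l.insertNth x z := fun x => rfl
  simp only [hins, Fin.insertNth_apply_same]
  have hd : ∀ x : ℝ, HasDerivAt (fun x : ℝ => (l.insertNth x z : Fin (N + 1) → ℝ))
      (Pi.single l 1) x := by
    intro x
    rw [hasDerivAt_pi]
    intro j
    obtain rfl | ⟨j, rfl⟩ := l.eq_self_or_eq_succAbove j
    · simpa using hasDerivAt_id' x
    · simpa using hasDerivAt_const x (z j)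
  have hcI : Continuous fun x : ℝ => (l.insertNth x z : Fin (N + 1) → ℝ) :=
    continuous_iff_continuousAt.2 fun x => (hd x).continuousAt
  refine integral_id_mul_gaussianReal (fun x => ?_) (hc2.comp hcI) (fun x => hC _) (fun x => hC' _)
  rw [partialDeriv_one]
  exact ((hf.1.differentiable (by simp)) _).hasFDerivAt.comp_hasDerivAt x (hd x)

/-- The total mass of the `m`-th derivative of `f` under the Gaussian measure is controlled by the
`L²` norm of `f`, with a constant that does not depend on the dimension. One derivative at a time is
removed: writing the Gaussian vector as `(Y + Z)/√2` with independent `Y` and `Z`, integration by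
parts in `Y` replaces a derivative by a factor linear in `Y`, and the other derivatives fall on the
function of `Z` alone. -/
theorem exists_abs_sum_integral_partialDeriv_le (m : ℕ) :
    ∃ C : ℝ, 0 ≤ C ∧ ∀ (N : ℕ) (f : (Fin N → ℝ) → ℝ), IsCbInfty f → ∀ u : (Fin m → Fin N) → ℝ,
      |∑ i, u i * ∫ y, partialDeriv f i y ∂(standardGaussian N)|
        ≤ C * √(∑ i, u i ^ 2) * √(∫ y, f y ^ 2 ∂(standardGaussian N)) := by
  induction m with
  | zero =>
    refine ⟨1, zero_le_one, fun N f hf u => ?_⟩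
    obtain ⟨C, hC⟩ := hf.bounded
    have hmem : MemLp f 2 (standardGaussian N) :=
      MemLp.of_bound hf.1.continuous.aestronglyMeasurable C (Filter.Eventually.of_forall hC)
    have h1 := abs_integral_mul_le (memLp_const (μ := standardGaussian N) (p := 2) (1 : ℝ)) hmem
    simp only [one_mul, one_pow, integral_const, probReal_univ, smul_eq_mul, mul_one,
      Real.sqrt_one] at h1
    simp only [partialDeriv_zero, Finset.univ_unique, Finset.sum_singleton, Real.sqrt_sq_eq_abs,
      one_mul, abs_mul]
    exact mul_le_mul_of_nonneg_left h1 (abs_nonneg _)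
  | succ m ih =>
    obtain ⟨C, hC0, hC⟩ := ih
    -- The coefficient `a = 1/√2` of the splitting into two independent vectors.
    obtain ⟨a, ha0, ha⟩ : ∃ a : ℝ, 0 < a ∧ a ^ 2 + a ^ 2 = 1 := by
      refine ⟨√(1 / 2), by positivity, ?_⟩
      rw [Real.sq_sqrt (by norm_num)]
      norm_num
    refine ⟨a⁻¹ * (a ^ m)⁻¹ * C, by positivity, fun N f hf u => ?_⟩
    set γ := standardGaussian N with hγ
    have hrot : MeasurePreserving (fun p : (Fin N → ℝ) × (Fin N → ℝ) => a • p.1 + a • p.2)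
        (γ.prod γ) γ := measurePreserving_rotation ha
    obtain ⟨B, hB⟩ := hf.bounded
    -- One integration by parts in the first of the two independent vectors.
    have hibp : ∀ (l : Fin N) (j : Fin m → Fin N),
        ∫ y, partialDeriv f (Fin.cons l j : Fin (m + 1) → Fin N) y ∂γ
          = a⁻¹ * ∫ y, y l * ∫ z, partialDeriv f j (a • y + a • z) ∂γ ∂γ := by
      intro l j
      have hq := hf.partialDeriv j
      obtain ⟨Bq, hBq⟩ := hq.bounded
      obtain ⟨Bl, hBl⟩ := (hq.partialDeriv fun _ : Fin 1 => l).bounded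
      have hcq := hq.1.continuous
      have hcl := (hq.partialDeriv fun _ : Fin 1 => l).1.continuous
      rw [partialDeriv_cons hf.1, ← integral_comp_of_measurePreserving hrot
        hcl.aestronglyMeasurable, integral_prod_symm]
      swap
      · exact Integrable.of_bound (by fun_prop) Bl (Filter.Eventually.of_forall fun _ => hBl _)
      have h1 : ∀ z : Fin N → ℝ,
          ∫ y, partialDeriv (partialDeriv f j) (fun _ : Fin 1 => l) (a • y + a • z) ∂γ
            = a⁻¹ * ∫ y, y l * partialDeriv f j (a • y + a • z) ∂γ := by
        intro z
        have h2 := integral_eval_mul_standardGaussian (hq.comp_affine (a • z) a) l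
        simp only [partialDeriv_comp_affine hq.1, pow_one, integral_const_mul] at h2
        simp only [add_comm (a • _) (a • z)]
        rw [h2, ← mul_assoc, inv_mul_cancel₀ ha0.ne', one_mul]
      simp only [h1]
      rw [integral_const_mul, integral_integral_swap]
      · simp only [integral_const_mul]
      · have h3 : Integrable (fun p : (Fin N → ℝ) × (Fin N → ℝ) => p.2 l) (γ.prod γ) :=
          ((memLp_standardGaussian_eval l).integrable (by norm_num)).comp_snd γ
        exact h3.mul_bdd (c := Bq) (by fun_prop) (Filter.Eventually.of_forall fun _ => hBq _)
    -- The coefficients left once the removed derivative has become the random factor `y l`.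
    let v : (Fin N → ℝ) → (Fin m → Fin N) → ℝ := fun y j =>
      ∑ l, y l * u (Fin.cons l j : Fin (m + 1) → Fin N)
    have hvL2 : ∀ j, MemLp (fun y => v y j) 2 γ := fun j =>
      memLp_finsetSum _ fun l _ => (memLp_standardGaussian_eval l).mul_const _
    have hvsq : ∀ j, ∫ y, v y j ^ 2 ∂γ = ∑ l, u (Fin.cons l j : Fin (m + 1) → Fin N) ^ 2 := by
      intro j
      have h1 : ∀ y, v y j ^ 2 = ∑ l, ∑ l', (u (Fin.cons l j : Fin (m + 1) → Fin N)
          * u (Fin.cons l' j : Fin (m + 1) → Fin N)) * (y l * y l') := by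
        intro y
        rw [pow_two, Finset.sum_mul_sum]
        refine Finset.sum_congr rfl fun l _ => Finset.sum_congr rfl fun l' _ => ?_
        ring
      have h2 : ∀ l l' : Fin N, Integrable (fun y : Fin N → ℝ => y l * y l') γ := fun l l' =>
        (memLp_standardGaussian_eval l).integrable_mul (memLp_standardGaussian_eval l')
      simp only [h1]
      rw [integral_finsetSum _ fun l _ => integrable_finsetSum _ fun l' _ => (h2 l l').const_mul _]
      refine Finset.sum_congr rfl fun l _ => ?_
      rw [integral_finsetSum _ fun l' _ => (h2 l l').const_mul _]
      simp only [integral_const_mul, hγ, integral_standardGaussian_eval_mul_eval]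
      simp [pow_two]
    have hqc : ∀ j : Fin m → Fin N, Continuous (partialDeriv f j) := fun j =>
      (hf.partialDeriv j).1.continuous
    have hin : ∀ (j : Fin m → Fin N), ∃ Bq, ∀ y,
        ‖∫ z, partialDeriv f j (a • y + a • z) ∂γ‖ ≤ Bq := by
      intro j
      obtain ⟨Bq, hBq⟩ := (hf.partialDeriv j).bounded
      refine ⟨Bq, fun y => ?_⟩
      have := norm_integral_le_of_norm_le_const (μ := γ) (C := Bq)
        (f := fun z => partialDeriv f j (a • y + a • z))
        (Filter.Eventually.of_forall fun z => hBq _)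
      simpa using this
    have hinm : ∀ (j : Fin m → Fin N),
        AEStronglyMeasurable (fun y => ∫ z, partialDeriv f j (a • y + a • z) ∂γ) γ := by
      intro j
      have h1 : Continuous fun p : (Fin N → ℝ) × (Fin N → ℝ) =>
          partialDeriv f j (a • p.1 + a • p.2) := (hqc j).comp (by fun_prop)
      exact h1.stronglyMeasurable.integral_prod_right.aestronglyMeasurable
    have hsum : ∑ i, u i * ∫ y, partialDeriv f i y ∂γ
        = a⁻¹ * ∫ y, ∑ j, v y j * ∫ z, partialDeriv f j (a • y + a • z) ∂γ ∂γ := by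
      rw [← (Fin.consEquiv fun _ : Fin (m + 1) => Fin N).sum_comp, Fintype.sum_prod_type]
      have hint : ∀ (l : Fin N) (j : Fin m → Fin N), Integrable (fun y : Fin N → ℝ =>
          y l * ∫ z, partialDeriv f j (a • y + a • z) ∂γ) γ := by
        intro l j
        obtain ⟨Bq, hBq⟩ := hin j
        exact ((memLp_standardGaussian_eval l).integrable (by norm_num)).mul_bdd (c := Bq)
          (hinm j) (Filter.Eventually.of_forall hBq)
      have h1 : ∀ y, ∑ j, v y j * ∫ z, partialDeriv f j (a • y + a • z) ∂γ
          = ∑ l, ∑ j, u (Fin.cons l j : Fin (m + 1) → Fin N)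
            * (y l * ∫ z, partialDeriv f j (a • y + a • z) ∂γ) := by
        intro y
        rw [Finset.sum_comm]
        refine Finset.sum_congr rfl fun j _ => ?_
        rw [Finset.sum_mul]
        refine Finset.sum_congr rfl fun l _ => ?_
        ring
      simp only [h1]
      rw [integral_finsetSum _ fun l _ => integrable_finsetSum _ fun j _ => (hint l j).const_mul _,
        Finset.mul_sum]
      refine Finset.sum_congr rfl fun l _ => ?_
      rw [integral_finsetSum _ fun j _ => (hint l j).const_mul _, Finset.mul_sum]
      refine Finset.sum_congr rfl fun j _ => ?_
      change u (Fin.cons l j) * ∫ y, partialDeriv f (Fin.cons l j : Fin (m + 1) → Fin N) y ∂γ = _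
      rw [integral_const_mul, hibp]
      ring
    let A : (Fin N → ℝ) → ℝ := fun y => √(∑ j, v y j ^ 2)
    let R : (Fin N → ℝ) → ℝ := fun y => √(∫ z, f (a • y + a • z) ^ 2 ∂γ)
    have hAsq : ∀ y, A y ^ 2 = ∑ j, v y j ^ 2 := fun y =>
      Real.sq_sqrt (Finset.sum_nonneg fun _ _ => sq_nonneg _)
    have hRsq : ∀ y, R y ^ 2 = ∫ z, f (a • y + a • z) ^ 2 ∂γ := fun y =>
      Real.sq_sqrt (integral_nonneg fun _ => sq_nonneg _)
    have hfc : Continuous fun p : (Fin N → ℝ) × (Fin N → ℝ) => f (a • p.1 + a • p.2) ^ 2 :=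
      (hf.1.continuous.comp (by fun_prop)).pow 2
    have hfi : Integrable (fun p : (Fin N → ℝ) × (Fin N → ℝ) => f (a • p.1 + a • p.2) ^ 2)
        (γ.prod γ) := by
      refine Integrable.of_bound hfc.aestronglyMeasurable (B ^ 2)
        (Filter.Eventually.of_forall fun p => ?_)
      rw [norm_pow]
      exact pow_le_pow_left₀ (norm_nonneg _) (hB _) 2
    have hAm : MemLp A 2 γ := by
      have h1 : AEStronglyMeasurable A γ := by
        have : Continuous A := by
          simp only [A, v]
          fun_prop
        exact this.aestronglyMeasurable
      rw [memLp_two_iff_integrable_sq h1]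
      simp only [hAsq]
      exact integrable_finsetSum _ fun j _ => (hvL2 j).integrable_sq
    have hRm : MemLp R 2 γ := by
      have h1 : AEStronglyMeasurable R γ :=
        (hfc.stronglyMeasurable.integral_prod_right.measurable.sqrt).aestronglyMeasurable
      rw [memLp_two_iff_integrable_sq h1]
      simp only [hRsq]
      exact hfi.integral_prod_left
    -- For fixed `y`, the induction hypothesis applies to the function `z ↦ f (a y + a z)`.
    have hpt : ∀ y, ‖∑ j, v y j * ∫ z, partialDeriv f j (a • y + a • z) ∂γ‖
        ≤ (a ^ m)⁻¹ * C * (A y * R y) := by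
      intro y
      have h1 := hC N _ (hf.comp_affine (a • y) a) (v y)
      simp only [partialDeriv_comp_affine hf.1, integral_const_mul] at h1
      have h2 : ∑ j, v y j * ∫ z, partialDeriv f j (a • y + a • z) ∂γ
          = (a ^ m)⁻¹ * ∑ j, v y j * (a ^ m * ∫ z, partialDeriv f j (a • y + a • z) ∂γ) := by
        rw [Finset.mul_sum]
        refine Finset.sum_congr rfl fun j _ => ?_
        field_simp
      rw [h2, norm_mul, Real.norm_of_nonneg (by positivity), mul_assoc]
      refine mul_le_mul_of_nonneg_left ?_ (by positivity)
      rw [← mul_assoc]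
      exact h1
    have hCS := abs_integral_mul_le hAm hRm
    have hA2 : ∫ y, A y ^ 2 ∂γ = ∑ i, u i ^ 2 := by
      simp only [hAsq]
      rw [integral_finsetSum _ fun j _ => (hvL2 j).integrable_sq]
      simp only [hvsq]
      rw [← (Fin.consEquiv fun _ : Fin (m + 1) => Fin N).sum_comp, Fintype.sum_prod_type,
        Finset.sum_comm]
      rfl
    have hR2 : ∫ y, R y ^ 2 ∂γ = ∫ y, f y ^ 2 ∂γ := by
      simp only [hRsq]
      rw [← integral_prod _ hfi]
      exact integral_comp_of_measurePreserving hrot (f := fun y => f y ^ 2)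
        (hf.1.continuous.pow 2).aestronglyMeasurable
    rw [hA2, hR2] at hCS
    rw [hsum, abs_mul, abs_of_pos (inv_pos.2 ha0)]
    have h4 : |∫ y, ∑ j, v y j * ∫ z, partialDeriv f j (a • y + a • z) ∂γ ∂γ|
        ≤ (a ^ m)⁻¹ * C * ∫ y, A y * R y ∂γ := by
      rw [← integral_const_mul]
      exact norm_integral_le_of_norm_le ((hAm.integrable_mul hRm).const_mul _)
        (Filter.Eventually.of_forall hpt)
    calc a⁻¹ * |∫ y, ∑ j, v y j * ∫ z, partialDeriv f j (a • y + a • z) ∂γ ∂γ|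
        ≤ a⁻¹ * ((a ^ m)⁻¹ * C * (√(∑ i, u i ^ 2) * √(∫ y, f y ^ 2 ∂γ))) := by
          refine mul_le_mul_of_nonneg_left (h4.trans ?_) (by positivity)
          exact mul_le_mul_of_nonneg_left ((le_abs_self _).trans hCS) (by positivity)
      _ = _ := by ring

/-! ### The law of Wiener-Itô integrals -/

theorem iSup_comap_eq_comap_pi {α ι : Type*} (X : ι → α → ℝ) :
    (⨆ t, MeasurableSpace.comap (X t) inferInstance)
      = MeasurableSpace.comap (fun a t => X t a) MeasurableSpace.pi := by
  rw [MeasurableSpace.pi, MeasurableSpace.comap_iSup]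
  congr 1
  funext t
  rw [MeasurableSpace.comap_comp]
  rfl

variable {Ω : Type*} [MeasurableSpace Ω] {P : Measure Ω} {T : ℝ} {W : Time T → Ω → ℝ}

theorem IsWiener.isProbabilityMeasure (hT : 0 < T) (hW : IsWiener T W P) :
    IsProbabilityMeasure P :=
  ((hW.hasLaw_eval ⟨0, le_rfl, hT.le⟩).hasGaussianLaw).isProbabilityMeasure

theorem IsWiener.isGaussianProcess (hT : 0 < T) (hW : IsWiener T W P) :
    IsGaussianProcess W P := by
  let _ : OrderBot (Time T) :=
    { bot := ⟨0, le_rfl, hT.le⟩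
      bot_le := fun t => t.2.1 }
  exact HasIndepIncrements.isGaussianProcess (fun t => (hW.hasLaw_eval t).hasGaussianLaw)
    (hW.zero ⊥ rfl) hW.indep

theorem coeFn_linearCombination_toL2 (hW : IsWiener T W P) (a : Time T →₀ ℝ) :
    Finsupp.linearCombination ℝ hW.toL2 a =ᵐ[P] fun ω => ∑ t ∈ a.support, a t * W t ω := by
  rw [Finsupp.linearCombination_apply, Finsupp.sum]
  have h1 : ∀ t, hW.toL2 t =ᵐ[P] W t := fun t => (hW.memLp t).coeFn_toLp
  have h2 := Lp.coeFn_finsetSum (μ := P) a.support fun t => a t • hW.toL2 t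
  refine h2.trans ?_
  have h3 : ∀ᵐ ω ∂P, ∀ t ∈ a.support, (a t • hW.toL2 t) ω = a t * W t ω := by
    rw [Filter.eventually_all_finset]
    intro t _
    filter_upwards [Lp.coeFn_smul (a t) (hW.toL2 t), h1 t] with ω h4 h5
    simp [h4, h5]
  filter_upwards [h3] with ω h4
  rw [Finset.sum_apply]
  exact Finset.sum_congr rfl h4

theorem integral_exp_linearCombination_toL2 (hT : 0 < T) (hW : IsWiener T W P)
    (a : Time T →₀ ℝ) :
    ∫ ω, Complex.exp ((Finsupp.linearCombination ℝ hW.toL2 a ω : ℝ) * Complex.I) ∂P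
      = Complex.exp (-((‖Finsupp.linearCombination ℝ hW.toL2 a‖ ^ 2 : ℝ) : ℂ) / 2) := by
  have := hW.isProbabilityMeasure hT
  set X : Lp ℝ 2 P := Finsupp.linearCombination ℝ hW.toL2 a with hX
  have hae := coeFn_linearCombination_toL2 hW a
  have hg : HasGaussianLaw X P := by
    have h1 := (hW.isGaussianProcess hT).hasGaussianLaw a.support
    let L : (a.support → ℝ) →L[ℝ] ℝ := ∑ t : a.support, a t • ContinuousLinearMap.proj t
    have h2 := h1.map_fun L
    refine h2.congr (Filter.EventuallyEq.symm ?_)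
    filter_upwards [hae] with ω hω
    rw [hω]
    simp only [L, sum_apply, smul_apply,
      ContinuousLinearMap.proj_apply, smul_eq_mul]
    exact (Finset.sum_coe_sort a.support fun t => a t * W t ω).symm
  have hmean : ∫ ω, X ω ∂P = 0 := by
    rw [integral_congr_ae hae]
    have h1 : ∀ t, Integrable (W t) P := fun t => (hW.memLp t).integrable (by norm_num)
    rw [integral_finsetSum _ fun t _ => (h1 t).const_mul _]
    refine Finset.sum_eq_zero fun t _ => ?_
    rw [integral_const_mul]
    have h2 := (hW.hasLaw_eval t).integral_eq
    rw [h2, integral_id_gaussianReal, mul_zero]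
  have hvar : Var[X; P] = ‖X‖ ^ 2 := by
    rw [variance_of_integral_eq_zero (Lp.aestronglyMeasurable X).aemeasurable hmean,
      ← real_inner_self_eq_norm_sq, L2.inner_def]
    simp [pow_two]
  have h3 := hg.map_eq_gaussianReal
  rw [hmean, hvar] at h3
  have h4 := charFun_gaussianReal (μ := 0) (v := (‖X‖ ^ 2).toNNReal) 1
  rw [← h3, charFun_apply_real, integral_map hg.aemeasurable (by fun_prop)] at h4
  simp only [Complex.ofReal_one, one_mul] at h4
  rw [h4]
  congr 1
  simp
  ring

theorem continuous_integral_exp [IsProbabilityMeasure P] :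
    Continuous fun X : Lp ℝ 2 P => ∫ ω, Complex.exp ((X ω : ℝ) * Complex.I) ∂P := by
  have hi : ∀ X : Lp ℝ 2 P, Integrable (fun ω => Complex.exp ((X ω : ℝ) * Complex.I)) P := by
    intro X
    refine Integrable.of_bound ?_ 1 (Filter.Eventually.of_forall fun ω => ?_)
    · have h := (Lp.aestronglyMeasurable X).aemeasurable
      exact AEMeasurable.aestronglyMeasurable (by fun_prop)
    · rw [Complex.norm_exp_ofReal_mul_I]
  refine (LipschitzWith.of_dist_le_mul (K := 1) fun X Y => ?_).continuous
  rw [NNReal.coe_one, one_mul, dist_eq_norm, dist_eq_norm, ← integral_sub (hi X) (hi Y)]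
  have h1 : ∀ᵐ ω ∂P, ‖Complex.exp ((X ω : ℝ) * Complex.I) - Complex.exp ((Y ω : ℝ) * Complex.I)‖
      ≤ |(X - Y : Lp ℝ 2 P) ω| := by
    filter_upwards [Lp.coeFn_sub X Y] with ω hω
    have h2 : Complex.exp ((X ω : ℝ) * Complex.I) - Complex.exp ((Y ω : ℝ) * Complex.I)
        = Complex.exp ((Y ω : ℝ) * Complex.I)
          * (Complex.exp (Complex.I * ((X ω - Y ω : ℝ) : ℂ)) - 1) := by
      rw [mul_sub, ← Complex.exp_add, mul_one]
      congr 2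
      push_cast
      ring
    rw [h2, norm_mul, Complex.norm_exp_ofReal_mul_I, one_mul, hω]
    exact Real.norm_exp_I_mul_ofReal_sub_one_le
  have h2 : MemLp (fun ω => |(X - Y : Lp ℝ 2 P) ω|) 2 P := (Lp.memLp (X - Y)).abs
  refine (norm_integral_le_of_norm_le (h2.integrable (by norm_num)) h1).trans ?_
  have h3 := abs_integral_mul_le (memLp_const (μ := P) (p := 2) (1 : ℝ)) h2
  have h4 := norm_toLp_eq_sqrt (Lp.memLp (X - Y))
  rw [Lp.toLp_coeFn] at h4
  simp only [one_mul, one_pow, integral_const, probReal_univ, smul_eq_mul, mul_one,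
      Real.sqrt_one, sq_abs] at h3
  rw [h4]
  exact (le_abs_self _).trans h3

/-- Each Wiener-Itô integral `I(h)` is centred Gaussian with variance `‖h‖²`, in terms of its
characteristic function at `1`. The identity passes from step functions to all `h` by density. -/
theorem integral_exp_wienerIntegral (hT : 0 < T) (hW : IsWiener T W P)
    (h : Lp ℝ 2 (timeMeasure T)) :
    ∫ ω, Complex.exp ((wienerIntegral hW h ω : ℝ) * Complex.I) ∂P
      = Complex.exp (-((‖h‖ ^ 2 : ℝ) : ℂ) / 2) := by
  have := hW.isProbabilityMeasure hT
  refine (denseRange_stepIndicator hT).induction_on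
    (p := fun h => ∫ ω, Complex.exp ((wienerIntegral hW h ω : ℝ) * Complex.I) ∂P
      = Complex.exp (-((‖h‖ ^ 2 : ℝ) : ℂ) / 2)) h
    (isClosed_eq (continuous_integral_exp.comp (wienerIntegral hW).continuous) (by fun_prop))
    fun a => ?_
  rw [wienerIntegral, LinearMap.extendOfNorm_eq (denseRange_stepIndicator hT)
    ⟨1, fun a => by rw [one_mul, hW.norm_linearCombination]⟩, ← hW.norm_linearCombination]
  exact integral_exp_linearCombination_toL2 hT hW a

theorem coeFn_wienerIntegral_sum (hW : IsWiener T W P) {ι : Type*} (s : Finset ι) (c : ι → ℝ)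
    (e : ι → Lp ℝ 2 (timeMeasure T)) :
    wienerIntegral hW (∑ j ∈ s, c j • e j)
      =ᵐ[P] fun ω => ∑ j ∈ s, c j * wienerIntegral hW (e j) ω := by
  rw [map_sum]
  refine (Lp.coeFn_finsetSum (μ := P) s fun j => wienerIntegral hW (c j • e j)).trans ?_
  have h3 : ∀ᵐ ω ∂P, ∀ j ∈ s,
      wienerIntegral hW (c j • e j) ω = c j * wienerIntegral hW (e j) ω := by
    rw [Filter.eventually_all_finset]
    intro j _
    rw [map_smul]
    filter_upwards [Lp.coeFn_smul (c j) (wienerIntegral hW (e j))] with ω h4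
    simp [h4]
  filter_upwards [h3] with ω h4
  rw [Finset.sum_apply]
  exact Finset.sum_congr rfl h4

/-- The Wiener-Itô integrals of an orthonormal family form a standard Gaussian vector. -/
theorem map_wienerIntegral_of_orthonormal (hT : 0 < T) (hW : IsWiener T W P) {N : ℕ}
    {e : Fin N → Lp ℝ 2 (timeMeasure T)} (he : Orthonormal ℝ e) :
    P.map (fun ω j => wienerIntegral hW (e j) ω) = standardGaussian N := by
  have := hW.isProbabilityMeasure hT
  have hm : AEMeasurable (fun ω j => wienerIntegral hW (e j) ω) P :=
    aemeasurable_pi_lambda _ fun j => (Lp.aestronglyMeasurable _).aemeasurable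
  have := Measure.isProbabilityMeasure_map hm
  refine Measure.ext_of_charFunDual ?_
  funext K
  rw [charFunDual_standardGaussian, charFunDual_apply, integral_map hm (by fun_prop)]
  have h1 := coeFn_wienerIntegral_sum hW Finset.univ (fun j => K (Pi.single j 1)) e
  have h2 := integral_exp_wienerIntegral hT hW (∑ j, K (Pi.single j 1) • e j)
  have h3 : ‖∑ j, K (Pi.single j 1) • e j‖ ^ 2 = ∑ j, K (Pi.single j 1) ^ 2 := by
    rw [← real_inner_self_eq_norm_sq, he.inner_sum]
    simp [pow_two]
  rw [h3] at h2
  rw [← h2]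
  refine integral_congr_ae ?_
  filter_upwards [h1] with ω hω
  rw [hω]
  congr 3
  have h4 := pi_eq_sum_univ' (fun j => wienerIntegral hW (e j) ω)
  conv_lhs => rw [h4]
  rw [map_sum]
  refine Finset.sum_congr rfl fun j _ => ?_
  rw [map_smul, smul_eq_mul, mul_comm]

/-! ### Density of the smooth bounded random variables -/

/-- The random variable `φ(I(h))` for a smooth `φ` with derivatives bounded by `1`. -/
noncomputable def SmoothVar.ofReal {φ : ℝ → ℝ} (hφ : ContDiff ℝ (⊤ : ℕ∞) φ)
    (hb : ∀ (n : ℕ) (x : ℝ), |iteratedDeriv n φ x| ≤ 1) (h : Lp ℝ 2 (timeMeasure T)) :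
    SmoothVar T where
  n := 1
  f := fun y => φ (y 0)
  smooth := isCbInfty_of_iteratedDeriv hφ hb
  h := fun _ => h
  memLp := fun _ => Lp.memLp h

theorem SmoothVar.val_ofReal (hW : IsWiener T W P) {φ : ℝ → ℝ} (hφ : ContDiff ℝ (⊤ : ℕ∞) φ)
    (hb : ∀ (n : ℕ) (x : ℝ), |iteratedDeriv n φ x| ≤ 1) (h : Lp ℝ 2 (timeMeasure T)) (ω : Ω) :
    (SmoothVar.ofReal hφ hb h).val hW ω = φ (wienerIntegral hW h ω) := by
  simp [SmoothVar.ofReal, SmoothVar.val, SmoothVar.vec]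

/-- The real and imaginary parts of `exp (i I(h))` are smooth bounded random variables. -/
theorem integral_exp_wienerIntegral_mul_eq_zero (hT : 0 < T) (hW : IsWiener T W P) {G : Lp ℝ 2 P}
    (hG : ∀ Φ : SmoothVar T, ∫ ω, Φ.val hW ω * G ω ∂P = 0) (h : Lp ℝ 2 (timeMeasure T)) :
    ∫ ω, (G ω : ℂ) * Complex.exp ((wienerIntegral hW h ω : ℝ) * Complex.I) ∂P = 0 := by
  have := hW.isProbabilityMeasure hT
  have hc := hG (SmoothVar.ofReal Real.contDiff_cos Real.abs_iteratedDeriv_cos_le_one h)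
  have hs := hG (SmoothVar.ofReal Real.contDiff_sin Real.abs_iteratedDeriv_sin_le_one h)
  simp only [SmoothVar.val_ofReal] at hc hs
  have hGi : Integrable G P := (Lp.memLp G).integrable (by norm_num)
  have hm := (Lp.aestronglyMeasurable (wienerIntegral hW h))
  have hci : Integrable (fun ω => Real.cos (wienerIntegral hW h ω) * G ω) P :=
    hGi.bdd_mul (c := 1) (Real.continuous_cos.comp_aestronglyMeasurable hm)
      (Filter.Eventually.of_forall fun ω => Real.abs_cos_le_one _)
  have hsi : Integrable (fun ω => Real.sin (wienerIntegral hW h ω) * G ω) P :=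
    hGi.bdd_mul (c := 1) (Real.continuous_sin.comp_aestronglyMeasurable hm)
      (Filter.Eventually.of_forall fun ω => Real.abs_sin_le_one _)
  have h1 : ∀ ω, (G ω : ℂ) * Complex.exp ((wienerIntegral hW h ω : ℝ) * Complex.I)
      = ((Real.cos (wienerIntegral hW h ω) * G ω : ℝ) : ℂ)
        + ((Real.sin (wienerIntegral hW h ω) * G ω : ℝ) : ℂ) * Complex.I := by
    intro ω
    rw [Complex.exp_mul_I]
    push_cast
    ring
  simp only [h1]
  rw [integral_add hci.ofReal (hsi.ofReal.mul_const _), integral_mul_const, integral_complex_ofReal,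
    integral_complex_ofReal, hc, hs]
  simp

/-- Integration against the measure with density `G⁺`. -/
theorem integral_withDensity_ofReal [IsProbabilityMeasure P] (G : Lp ℝ 2 P) (f : Ω → ℂ) :
    ∫ ω, f ω ∂(P.withDensity fun ω => ENNReal.ofReal (G ω)) = ∫ ω, (max (G ω) 0 : ℝ) * f ω ∂P := by
  rw [integral_withDensity_eq_integral_toReal_smul₀
    (Lp.aestronglyMeasurable G).aemeasurable.ennreal_ofReal
    (Filter.Eventually.of_forall fun _ => ENNReal.ofReal_lt_top)]
  simp [ENNReal.toReal_ofReal']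

/-- An element of `L²(Ω)` orthogonal to all smooth bounded random variables vanishes. The measures
with densities `G⁺` and `G⁻` give the same law to the path `W`, as the characteristic functions of
its finite-dimensional marginals agree. -/
theorem eq_zero_of_forall_integral_val_mul_eq_zero (hT : 0 < T) (hW : IsWiener T W P)
    (hgen : IsGeneratedBy W P) {G : Lp ℝ 2 P}
    (hG : ∀ Φ : SmoothVar T, ∫ ω, Φ.val hW ω * G ω ∂P = 0) : G = 0 := by
  have := hW.isProbabilityMeasure hT
  have hGi : Integrable G P := (Lp.memLp G).integrable (by norm_num)
  set μ := P.withDensity fun ω => ENNReal.ofReal (G ω) with hμ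
  set ν := P.withDensity fun ω => ENNReal.ofReal ((-G : Lp ℝ 2 P) ω) with hν
  have hnegi : Integrable (-G : Lp ℝ 2 P) P := (Lp.memLp (-G)).integrable (by norm_num)
  have : IsFiniteMeasure μ := isFiniteMeasure_withDensity_ofReal hGi.2
  have : IsFiniteMeasure ν := isFiniteMeasure_withDensity_ofReal hnegi.2
  have hpath : Measurable fun ω t => W t ω := measurable_pi_lambda _ hW.measurable
  have hlaw : μ.map (fun ω t => W t ω) = ν.map (fun ω t => W t ω) := by
    have hfd : ∀ I : Finset (Time T), μ.map (fun ω => I.restrict fun t => W t ω)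
        = ν.map (fun ω => I.restrict fun t => W t ω) := by
      intro I
      have hmI : Measurable fun ω => I.restrict fun t => W t ω :=
        (Finset.measurable_restrict I).comp hpath
      refine Measure.ext_of_charFunDual ?_
      funext K
      have h1 := integral_exp_wienerIntegral_mul_eq_zero hT hW hG
        (∑ t : I, K (Pi.single t 1) • stepIndicator (t : Time T))
      have h2 := coeFn_wienerIntegral_sum hW (Finset.univ : Finset I)
        (fun t => K (Pi.single t 1)) fun t => stepIndicator (t : Time T)
      have h3 : ∀ᵐ ω ∂P, ∀ t : I, wienerIntegral hW (stepIndicator (t : Time T)) ω = W t ω := by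
        rw [ae_all_iff]
        intro t
        rw [wienerIntegral_stepIndicator hT]
        exact (hW.memLp t).coeFn_toLp
      have h4 : ∀ᵐ ω ∂P, wienerIntegral hW
          (∑ t : I, K (Pi.single t 1) • stepIndicator (t : Time T)) ω
            = K (I.restrict fun t => W t ω) := by
        filter_upwards [h2, h3] with ω h5 h6
        rw [h5]
        conv_rhs => rw [pi_eq_sum_univ' (I.restrict fun t => W t ω)]
        rw [map_sum]
        refine Finset.sum_congr rfl fun t _ => ?_
        rw [h6, map_smul, smul_eq_mul, mul_comm]
        rfl
      have hmK : Measurable fun ω => K (I.restrict fun t => W t ω) := K.measurable.comp hmI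
      have hexp : ∀ X : Lp ℝ 2 P, Integrable (fun ω => ((max (X ω) 0 : ℝ) : ℂ)
          * Complex.exp ((K (I.restrict fun t => W t ω) : ℝ) * Complex.I)) P := by
        intro X
        have hX : Integrable (fun ω => max (X ω) 0) P :=
          ((Lp.memLp X).integrable (by norm_num)).pos_part
        refine hX.ofReal.mul_bdd (c := 1)
          ((Complex.measurable_ofReal.comp hmK).mul_const _).cexp.aestronglyMeasurable
          (Filter.Eventually.of_forall fun ω => ?_)
        rw [Complex.norm_exp_ofReal_mul_I]
      rw [charFunDual_apply, charFunDual_apply, integral_map hmI.aemeasurable (by fun_prop),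
        integral_map hmI.aemeasurable (by fun_prop), hμ, hν, integral_withDensity_ofReal,
        integral_withDensity_ofReal, ← sub_eq_zero, ← integral_sub (hexp _) (hexp _), ← h1]
      refine integral_congr_ae ?_
      filter_upwards [h4, Lp.coeFn_neg G] with ω h5 h6
      rw [h5, h6, ← sub_mul, ← Complex.ofReal_sub]
      congr 2
      simp only [Pi.neg_apply]
      rcases le_total (G ω) 0 with h | h
      · rw [max_eq_right h, max_eq_left (neg_nonneg.2 h)]
        ring
      · rw [max_eq_left h, max_eq_right (neg_nonpos.2 h)]
        ring
    have h1 := isProjectiveLimit_map (P := μ) (X := W) hpath.aemeasurable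
    have h2 := isProjectiveLimit_map (P := ν) (X := W) hpath.aemeasurable
    simp only [hfd] at h1
    exact h1.unique h2
  -- Equality of the laws of the path transfers to all events, as `W` generates the σ-algebra.
  have hset : ∀ A, MeasurableSet A → ∫ ω in A, G ω ∂P = 0 := by
    intro A hA
    obtain ⟨B, hB, hAB⟩ := hgen A hA
    rw [setIntegral_congr_set hAB]
    rw [iSup_comap_eq_comap_pi] at hB
    obtain ⟨S, hS, rfl⟩ := hB
    have hB' : MeasurableSet ((fun ω t => W t ω) ⁻¹' S) := hpath hS
    have h1 : μ ((fun ω t => W t ω) ⁻¹' S) = ν ((fun ω t => W t ω) ⁻¹' S) := by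
      rw [← Measure.map_apply hpath hS, ← Measure.map_apply hpath hS, hlaw]
    rw [hμ, hν, withDensity_apply _ hB', withDensity_apply _ hB'] at h1
    rw [integral_eq_lintegral_pos_part_sub_lintegral_neg_part hGi.integrableOn, h1, sub_eq_zero]
    congr 1
    refine lintegral_congr_ae (ae_restrict_of_ae ?_)
    filter_upwards [Lp.coeFn_neg G] with ω h6
    rw [h6, Pi.neg_apply]
  exact (Lp.eq_zero_iff_ae_eq_zero).2 (Lp.ae_eq_zero_of_forall_setIntegral_eq_zero G two_ne_zero
    ENNReal.ofNat_ne_top (fun s _ _ => hGi.integrableOn) fun s hs _ => hset s hs)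

/-! ### Malliavin derivatives of smooth bounded random variables -/

theorem SmoothVar.deriv_eq_iteratedFDeriv (Φ : SmoothVar T) (hW : IsWiener T W P) (k : ℕ) (ω : Ω)
    (x : Fin k → Time T) :
    Φ.deriv hW k ω x = iteratedFDeriv ℝ k Φ.f (Φ.vec hW ω) fun j i => Φ.h i (x j) := by
  rw [iteratedFDeriv_apply_eq_sum]
  rfl

/-- The derivative `D^k Φ` depends on the representation `Φ = f(I(h₁), …, I(hₙ))` only through
linear changes of the vector `(h₁, …, hₙ)`. -/
theorem SmoothVar.deriv_eq_of_comp {Φ Ψ : SmoothVar T} (hW : IsWiener T W P)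
    (A : (Fin Ψ.n → ℝ) →L[ℝ] (Fin Φ.n → ℝ)) (hf : Ψ.f = fun y => Φ.f (A y)) {ω : Ω}
    (hω : A (Ψ.vec hW ω) = Φ.vec hW ω) {k : ℕ} {x : Fin k → Time T}
    (hx : ∀ j, A (fun i => Ψ.h i (x j)) = fun i => Φ.h i (x j)) :
    Ψ.deriv hW k ω x = Φ.deriv hW k ω x := by
  rw [SmoothVar.deriv_eq_iteratedFDeriv, SmoothVar.deriv_eq_iteratedFDeriv, hf]
  have h1 := A.iteratedFDeriv_comp_right Φ.smooth.1 (Ψ.vec hW ω) (i := k) (by exact_mod_cast le_top)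
  change iteratedFDeriv ℝ k (Φ.f ∘ A) _ _ = _
  rw [h1, hω]
  simp only [ContinuousMultilinearMap.compContinuousLinearMap_apply, hx]

theorem SmoothVar.aemeasurable_vec (Φ : SmoothVar T) (hW : IsWiener T W P) :
    AEMeasurable (Φ.vec hW) P :=
  aemeasurable_pi_lambda _ fun _ => (Lp.aestronglyMeasurable _).aemeasurable

theorem SmoothVar.memLp_top_comp_vec (Φ : SmoothVar T) (hW : IsWiener T W P)
    {g : (Fin Φ.n → ℝ) → ℝ} (hg : IsCbInfty g) : MemLp (fun ω => g (Φ.vec hW ω)) ∞ P := by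
  obtain ⟨C, hC⟩ := hg.bounded
  exact memLp_top_of_bound
    (hg.1.continuous.measurable.comp_aemeasurable (Φ.aemeasurable_vec hW)).aestronglyMeasurable
    C (Filter.Eventually.of_forall fun ω => hC _)

theorem SmoothVar.memLp_val [IsFiniteMeasure P] (Φ : SmoothVar T) (hW : IsWiener T W P) :
    MemLp (Φ.val hW) 2 P :=
  (Φ.memLp_top_comp_vec hW Φ.smooth).mono_exponent le_top

theorem memLp_tensor {ι : Type*} {h : ι → Time T → ℝ} (hL : ∀ i, MemLp (h i) 2 (timeMeasure T))
    {k : ℕ} (i : Fin k → ι) :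
    MemLp (fun x : Fin k → Time T => ∏ j, h (i j) (x j)) 2 (cubeMeasure T k) := by
  have hm : AEStronglyMeasurable (fun x : Fin k → Time T => ∏ j, h (i j) (x j))
      (cubeMeasure T k) := by
    refine Finset.aestronglyMeasurable_fun_prod _ fun j _ => ?_
    exact (hL (i j)).1.comp_quasiMeasurePreserving
      (Measure.quasiMeasurePreserving_eval (μ := fun _ : Fin k => timeMeasure T) j)
  rw [memLp_two_iff_integrable_sq hm]
  simp only [← Finset.prod_pow]
  exact Integrable.fintype_prod (μ := fun _ => timeMeasure T) fun j => (hL (i j)).integrable_sq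

theorem SmoothVar.memLp_deriv [IsProbabilityMeasure P] (Φ : SmoothVar T) (hW : IsWiener T W P)
    (k : ℕ) :
    MemLp (fun z : Ω × (Fin k → Time T) => Φ.deriv hW k z.1 z.2) 2 (P.prod (cubeMeasure T k)) := by
  unfold SmoothVar.deriv
  refine memLp_finsetSum _ fun i _ => ?_
  have h1 : MemLp (fun z : Ω × (Fin k → Time T) => ∏ j, Φ.h (i j) (z.2 j)) 2
      (P.prod (cubeMeasure T k)) :=
    (memLp_tensor Φ.memLp i).comp_measurePreserving measurePreserving_snd
  obtain ⟨C, hC⟩ := (Φ.smooth.partialDeriv i).bounded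
  have h2 : MemLp (fun z : Ω × (Fin k → Time T) => partialDeriv Φ.f i (Φ.vec hW z.1)) ∞
      (P.prod (cubeMeasure T k)) := by
    refine memLp_top_of_bound ?_ C (Filter.Eventually.of_forall fun _ => hC _)
    exact (Φ.memLp_top_comp_vec hW (Φ.smooth.partialDeriv i)).1.comp_fst
  exact MemLp.mul' h1 h2

/-! ### The mean of a Malliavin derivative -/

/-- The function `E[D^k Φ]` on `[0, T]^k`. -/
noncomputable def SmoothVar.meanDeriv (Φ : SmoothVar T) (hW : IsWiener T W P) (k : ℕ)
    (x : Fin k → Time T) : ℝ :=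
  ∫ ω, Φ.deriv hW k ω x ∂P

theorem SmoothVar.meanDeriv_eq_sum [IsFiniteMeasure P] (Φ : SmoothVar T) (hW : IsWiener T W P)
    (k : ℕ) (x : Fin k → Time T) :
    Φ.meanDeriv hW k x = ∑ i : Fin k → Fin Φ.n,
      (∫ ω, partialDeriv Φ.f i (Φ.vec hW ω) ∂P) * ∏ j, Φ.h (i j) (x j) := by
  unfold SmoothVar.meanDeriv SmoothVar.deriv
  rw [integral_finsetSum]
  · simp only [integral_mul_const]
  · intro i _
    exact ((Φ.memLp_top_comp_vec hW (Φ.smooth.partialDeriv i)).integrable le_top).mul_const _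

theorem SmoothVar.memLp_meanDeriv [IsFiniteMeasure P] (Φ : SmoothVar T) (hW : IsWiener T W P)
    (k : ℕ) : MemLp (Φ.meanDeriv hW k) 2 (cubeMeasure T k) := by
  have h : Φ.meanDeriv hW k = fun x => _ := funext (Φ.meanDeriv_eq_sum hW k)
  rw [h]
  exact memLp_finsetSum _ fun i _ => (memLp_tensor Φ.memLp i).const_mul _

/-- For a deterministic `v` the pairing with `D^k Φ` sees only the mean of `D^k Φ`. -/
theorem pairing_const_eq_integral_mul_meanDeriv [IsProbabilityMeasure P] (hW : IsWiener T W P)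
    {k : ℕ} {v : (Fin k → Time T) → ℝ} (hv : MemLp v 2 (cubeMeasure T k)) (Φ : SmoothVar T) :
    pairing hW (fun _ => v) Φ = ∫ x, v x * Φ.meanDeriv hW k x ∂(cubeMeasure T k) := by
  have h1 : MemLp (fun z : Ω × (Fin k → Time T) => v z.2) 2 (P.prod (cubeMeasure T k)) :=
    hv.comp_measurePreserving measurePreserving_snd
  refine (integral_prod_symm _ (h1.integrable_mul (Φ.memLp_deriv hW k))).trans ?_
  simp only [Pi.mul_apply, integral_const_mul]
  rfl

theorem integral_tensor_mul_tensor {N k : ℕ} {e : Fin N → Lp ℝ 2 (timeMeasure T)}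
    (i i' : Fin k → Fin N) :
    ∫ x, (∏ j, e (i j) (x j)) * ∏ j, e (i' j) (x j) ∂(cubeMeasure T k)
      = ∏ j, inner ℝ (e (i j)) (e (i' j)) := by
  simp only [← Finset.prod_mul_distrib]
  rw [cubeMeasure, integral_fintype_prod_eq_prod (𝕜 := ℝ) (f := fun j t => e (i j) t * e (i' j) t)]
  refine Finset.prod_congr rfl fun j _ => ?_
  rw [L2.inner_def]
  congr 1
  funext t
  simp [mul_comm]

/-- Tensor products of the members of an orthonormal family are orthonormal. -/
theorem orthonormal_tensor {N k : ℕ} {e : Fin N → Lp ℝ 2 (timeMeasure T)} (he : Orthonormal ℝ e) :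
    Orthonormal ℝ fun i : Fin k → Fin N =>
      (memLp_tensor (h := fun j => e j) (fun j => Lp.memLp (e j)) i).toLp _ := by
  classical
  rw [orthonormal_iff_ite]
  intro i i'
  rw [inner_toLp, integral_tensor_mul_tensor]
  simp only [orthonormal_iff_ite.1 he]
  split_ifs with h
  · subst h
    simp
  · obtain ⟨j, hj⟩ := Function.ne_iff.1 h
    exact Finset.prod_eq_zero (Finset.mem_univ j) (if_neg hj)

/-- Every smooth bounded random variable is, almost surely and with its derivatives, a function
of the Wiener-Itô integrals of an orthonormal family. -/
theorem SmoothVar.exists_orthonormal (Φ : SmoothVar T) (hW : IsWiener T W P) :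
    ∃ (N : ℕ) (e : Fin N → Lp ℝ 2 (timeMeasure T)) (f : (Fin N → ℝ) → ℝ) (hf : IsCbInfty f),
      Orthonormal ℝ e ∧
      (∀ᵐ ω ∂P, (⟨N, f, hf, fun j => e j, fun j => Lp.memLp (e j)⟩ : SmoothVar T).val hW ω
        = Φ.val hW ω) ∧
      ∀ k, ∀ᵐ x ∂(cubeMeasure T k), ∀ᵐ ω ∂P,
        (⟨N, f, hf, fun j => e j, fun j => Lp.memLp (e j)⟩ : SmoothVar T).deriv hW k ω x
          = Φ.deriv hW k ω x := by
  let g : Fin Φ.n → Lp ℝ 2 (timeMeasure T) := fun i => (Φ.memLp i).toLp (Φ.h i)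
  let S : Submodule ℝ (Lp ℝ 2 (timeMeasure T)) := Submodule.span ℝ (Set.range g)
  have : FiniteDimensional ℝ S := FiniteDimensional.span_of_finite ℝ (Set.finite_range g)
  let b := stdOrthonormalBasis ℝ S
  let e : Fin (Module.finrank ℝ S) → Lp ℝ 2 (timeMeasure T) := fun j => b j
  have hgS : ∀ i, g i ∈ S := fun i => Submodule.subset_span (Set.mem_range_self i)
  let c : Fin Φ.n → Fin (Module.finrank ℝ S) → ℝ := fun i j => inner ℝ (b j) (⟨g i, hgS i⟩ : S)
  have hg : ∀ i, g i = ∑ j, c i j • e j := by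
    intro i
    have h1 := congrArg (Subtype.val) (b.sum_repr' (⟨g i, hgS i⟩ : S))
    rw [AddSubmonoidClass.coe_finsetSum] at h1
    exact h1.symm
  let A : (Fin (Module.finrank ℝ S) → ℝ) →L[ℝ] (Fin Φ.n → ℝ) :=
    ContinuousLinearMap.pi fun i => ∑ j, c i j • ContinuousLinearMap.proj j
  have hA : ∀ y i, A y i = ∑ j, c i j * y j := by
    intro y i
    simp [A]
  have he : Orthonormal ℝ e := b.orthonormal.comp_linearIsometry S.subtypeₗᵢ
  have hf : IsCbInfty fun y => Φ.f (A y) := Φ.smooth.comp_clm A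
  refine ⟨_, e, fun y => Φ.f (A y), hf, he, ?_⟩
  set Ψ : SmoothVar T := ⟨_, fun y => Φ.f (A y), hf, fun j => e j, fun j => Lp.memLp (e j)⟩ with hΨ
  have hvec : ∀ᵐ ω ∂P, A (Ψ.vec hW ω) = Φ.vec hW ω := by
    have h1 : ∀ᵐ ω ∂P, ∀ i, wienerIntegral hW (g i) ω
        = ∑ j, c i j * wienerIntegral hW (e j) ω := by
      rw [ae_all_iff]
      intro i
      rw [hg i]
      exact coeFn_wienerIntegral_sum hW _ _ _
    filter_upwards [h1] with ω hω
    funext i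
    rw [hA]
    refine Eq.trans (Finset.sum_congr rfl fun j _ => ?_) (hω i).symm
    change c i j * wienerIntegral hW ((Lp.memLp (e j)).toLp (e j)) ω = _
    rw [Lp.toLp_coeFn]
  have hpt : ∀ᵐ t ∂(timeMeasure T), A (fun j => Ψ.h j t) = fun i => Φ.h i t := by
    have h1 : ∀ᵐ t ∂(timeMeasure T), ∀ i, Φ.h i t = ∑ j, c i j * e j t := by
      rw [ae_all_iff]
      intro i
      have h2 : g i =ᵐ[timeMeasure T] fun t => ∑ j, c i j * e j t := by
        rw [hg i]
        refine (Lp.coeFn_finsetSum (μ := timeMeasure T) _ fun j => c i j • e j).trans ?_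
        have h3 : ∀ᵐ t ∂(timeMeasure T), ∀ j, (c i j • e j) t = c i j * e j t := by
          rw [ae_all_iff]
          intro j
          filter_upwards [Lp.coeFn_smul (c i j) (e j)] with t ht
          simp [ht]
        filter_upwards [h3] with t ht
        rw [Finset.sum_apply]
        exact Finset.sum_congr rfl fun j _ => ht j
      filter_upwards [h2, (Φ.memLp i).coeFn_toLp] with t h4 h5
      rw [← h4, h5]
    filter_upwards [h1] with t ht
    funext i
    rw [hA, ht i]
  refine ⟨?_, fun k => ?_⟩
  · filter_upwards [hvec] with ω hω
    change Φ.f (A (Ψ.vec hW ω)) = Φ.f (Φ.vec hW ω)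
    rw [hω]
  · have h1 : ∀ᵐ x ∂(cubeMeasure T k), ∀ j, A (fun i => Ψ.h i (x j)) = fun i => Φ.h i (x j) := by
      rw [ae_all_iff]
      intro j
      exact (Measure.quasiMeasurePreserving_eval (μ := fun _ : Fin k => timeMeasure T) j).ae hpt
    filter_upwards [h1] with x hx
    filter_upwards [hvec] with ω hω
    exact SmoothVar.deriv_eq_of_comp (Φ := Φ) (Ψ := Ψ) hW A rfl hω hx

/-- The map `Φ ↦ E[D^k Φ]` is bounded from `L²(Ω)` to `L²([0, T]^k)`. In terms of an orthonormal
family of integrands this is the dimension-free Gaussian bound, and Bessel's inequality controls the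
coefficients of `v`. -/
theorem exists_abs_integral_mul_meanDeriv_le (hT : 0 < T) (hW : IsWiener T W P) (k : ℕ) :
    ∃ C : ℝ, 0 ≤ C ∧ ∀ (Φ : SmoothVar T) (v : (Fin k → Time T) → ℝ)
      (hv : MemLp v 2 (cubeMeasure T k)),
      |∫ x, v x * Φ.meanDeriv hW k x ∂(cubeMeasure T k)|
        ≤ C * ‖hv.toLp v‖ * √(∫ ω, Φ.val hW ω ^ 2 ∂P) := by
  have := hW.isProbabilityMeasure hT
  obtain ⟨C, hC0, hC⟩ := exists_abs_sum_integral_partialDeriv_le k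
  refine ⟨C, hC0, fun Φ v hv => ?_⟩
  obtain ⟨N, e, f, hf, he, hval, hder⟩ := Φ.exists_orthonormal hW
  set Ψ : SmoothVar T := ⟨N, f, hf, fun j => e j, fun j => Lp.memLp (e j)⟩ with hΨ
  have hvec : Ψ.vec hW = fun ω j => wienerIntegral hW (e j) ω := by
    funext ω j
    change wienerIntegral hW ((Lp.memLp (e j)).toLp (e j)) ω = _
    rw [Lp.toLp_coeFn]
  have hlaw : ∀ {g : (Fin N → ℝ) → ℝ}, Continuous g →
      ∫ ω, g (Ψ.vec hW ω) ∂P = ∫ y, g y ∂(standardGaussian N) := by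
    intro g hg
    rw [← map_wienerIntegral_of_orthonormal hT hW he, ← hvec,
      integral_map (Ψ.aemeasurable_vec hW) hg.aestronglyMeasurable]
  have hten : ∀ i : Fin k → Fin N, MemLp (fun x : Fin k → Time T => ∏ j, e (i j) (x j)) 2
      (cubeMeasure T k) := memLp_tensor (h := fun j => e j) fun j => Lp.memLp (e j)
  let u : (Fin k → Fin N) → ℝ := fun i => ∫ x, (∏ j, e (i j) (x j)) * v x ∂(cubeMeasure T k)
  have h1 : ∫ x, v x * Φ.meanDeriv hW k x ∂(cubeMeasure T k)
      = ∑ i, u i * ∫ y, partialDeriv f i y ∂(standardGaussian N) := by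
    have h2 : ∫ x, v x * Φ.meanDeriv hW k x ∂(cubeMeasure T k)
        = ∫ x, ∑ i : Fin k → Fin N, (∫ y, partialDeriv f i y ∂(standardGaussian N))
          * ((∏ j, e (i j) (x j)) * v x) ∂(cubeMeasure T k) := by
      refine integral_congr_ae ?_
      filter_upwards [hder k] with x hx
      have h3 : Φ.meanDeriv hW k x = Ψ.meanDeriv hW k x := (integral_congr_ae hx).symm
      rw [h3, SmoothVar.meanDeriv_eq_sum, Finset.mul_sum]
      refine Finset.sum_congr rfl fun i _ => ?_
      rw [hlaw (g := partialDeriv Ψ.f i) (hf.partialDeriv i).1.continuous]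
      change v x * (_ * ∏ j, e (i j) (x j)) = _
      ring
    have hint : ∀ i : Fin k → Fin N, Integrable (fun x => (∫ y, partialDeriv f i y
        ∂(standardGaussian N)) * ((∏ j, e (i j) (x j)) * v x)) (cubeMeasure T k) := fun i =>
      ((hten i).integrable_mul hv).const_mul _
    rw [h2, integral_finsetSum _ fun i _ => hint i]
    refine Finset.sum_congr rfl fun i _ => ?_
    rw [integral_const_mul, mul_comm]
  have h4 : √(∑ i, u i ^ 2) ≤ ‖hv.toLp v‖ := by
    refine Real.sqrt_le_iff.2 ⟨norm_nonneg _, ?_⟩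
    have h5 := (orthonormal_tensor (k := k) he).sum_inner_products_le (hv.toLp v)
      (s := Finset.univ)
    refine le_trans (le_of_eq ?_) h5
    refine Finset.sum_congr rfl fun i _ => ?_
    rw [inner_toLp, Real.norm_eq_abs, sq_abs]
  have h6 : ∫ y, f y ^ 2 ∂(standardGaussian N) = ∫ ω, Φ.val hW ω ^ 2 ∂P := by
    rw [← hlaw (g := fun y => f y ^ 2) (hf.1.continuous.pow 2)]
    refine integral_congr_ae ?_
    filter_upwards [hval] with ω hω
    rw [← hω]
    rfl
  rw [h1, ← h6]
  refine (hC N f hf u).trans ?_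
  gcongr

/-! ### Smooth bounded random variables with a common vector of integrands -/

/-- The random variable `Φ`, written with a vector `h` that contains the integrands of `Φ` at the
positions `e`. -/
def SmoothVar.relabel (Φ : SmoothVar T) {n : ℕ} (h : Fin n → Time T → ℝ)
    (hL : ∀ i, MemLp (h i) 2 (timeMeasure T)) (e : Fin Φ.n → Fin n) : SmoothVar T where
  n := n
  f := fun y => Φ.f (ContinuousLinearMap.pi (R := ℝ) (φ := fun _ => ℝ)
    (fun i => ContinuousLinearMap.proj (e i)) y)
  smooth := Φ.smooth.comp_clm _
  h := h
  memLp := hL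

section

variable (Φ : SmoothVar T) (hW : IsWiener T W P) {n : ℕ} {h : Fin n → Time T → ℝ}
  (hL : ∀ i, MemLp (h i) 2 (timeMeasure T)) (e : Fin Φ.n → Fin n)

theorem SmoothVar.vec_relabel (he : ∀ i, h (e i) = Φ.h i) (ω : Ω) :
    (fun i => (Φ.relabel h hL e).vec hW ω (e i)) = Φ.vec hW ω := by
  funext i
  simp only [SmoothVar.vec, SmoothVar.relabel]
  congr 3
  exact MemLp.toLp_congr _ _ (by rw [he i])

theorem SmoothVar.val_relabel (he : ∀ i, h (e i) = Φ.h i) :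
    (Φ.relabel h hL e).val hW = Φ.val hW := by
  funext ω
  rw [SmoothVar.val, SmoothVar.val, ← Φ.vec_relabel hW hL e he]
  rfl

theorem SmoothVar.deriv_relabel (he : ∀ i, h (e i) = Φ.h i) :
    (Φ.relabel h hL e).deriv hW = Φ.deriv hW := by
  funext k ω x
  refine SmoothVar.deriv_eq_of_comp (Φ := Φ) (Ψ := Φ.relabel h hL e) hW
    (ContinuousLinearMap.pi fun i => ContinuousLinearMap.proj (e i)) rfl ?_ fun j => ?_
  · exact Φ.vec_relabel hW hL e he ω
  · funext i
    change h (e i) (x j) = Φ.h i (x j)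
    rw [he i]

end

/-- Two smooth bounded random variables are functions of a common vector of Wiener-Itô integrals. -/
theorem SmoothVar.exists_common (Φ Ψ : SmoothVar T) (hW : IsWiener T W P) :
    ∃ (n : ℕ) (h : Fin n → Time T → ℝ) (hL : ∀ i, MemLp (h i) 2 (timeMeasure T))
      (f g : (Fin n → ℝ) → ℝ) (hf : IsCbInfty f) (hg : IsCbInfty g),
      (⟨n, f, hf, h, hL⟩ : SmoothVar T).val hW = Φ.val hW ∧
      (⟨n, f, hf, h, hL⟩ : SmoothVar T).deriv hW = Φ.deriv hW ∧
      (⟨n, g, hg, h, hL⟩ : SmoothVar T).val hW = Ψ.val hW ∧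
      (⟨n, g, hg, h, hL⟩ : SmoothVar T).deriv hW = Ψ.deriv hW := by
  let h : Fin (Φ.n + Ψ.n) → Time T → ℝ := Fin.append Φ.h Ψ.h
  have hL : ∀ i, MemLp (h i) 2 (timeMeasure T) := by
    intro i
    refine Fin.addCases (fun i => ?_) (fun i => ?_) i
    · simpa [h] using Φ.memLp i
    · simpa [h] using Ψ.memLp i
  have h1 : ∀ i, h (Fin.castAdd Ψ.n i) = Φ.h i := fun i => Fin.append_left _ _ i
  have h2 : ∀ i, h (Fin.natAdd Φ.n i) = Ψ.h i := fun i => Fin.append_right _ _ i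
  exact ⟨_, h, hL, (Φ.relabel h hL _).f, (Ψ.relabel h hL _).f, (Φ.relabel h hL _).smooth,
    (Ψ.relabel h hL _).smooth, Φ.val_relabel hW hL _ h1, Φ.deriv_relabel hW hL _ h1,
    Ψ.val_relabel hW hL _ h2, Ψ.deriv_relabel hW hL _ h2⟩

theorem SmoothVar.exists_add (Φ Ψ : SmoothVar T) (hW : IsWiener T W P) :
    ∃ Θ : SmoothVar T, (∀ ω, Θ.val hW ω = Φ.val hW ω + Ψ.val hW ω) ∧
      ∀ k ω x, Θ.deriv hW k ω x = Φ.deriv hW k ω x + Ψ.deriv hW k ω x := by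
  obtain ⟨n, h, hL, f, g, hf, hg, e1, e2, e3, e4⟩ := SmoothVar.exists_common Φ Ψ hW
  refine ⟨⟨n, fun y => f y + g y, hf.add hg, h, hL⟩, fun ω => ?_, fun k ω x => ?_⟩
  · rw [← e1, ← e3]
    rfl
  · rw [← e2, ← e4]
    simp only [SmoothVar.deriv, partialDeriv_add hf.1 hg.1, add_mul, Finset.sum_add_distrib]
    rfl

theorem SmoothVar.exists_smul (c : ℝ) (Φ : SmoothVar T) (hW : IsWiener T W P) :
    ∃ Θ : SmoothVar T, (∀ ω, Θ.val hW ω = c * Φ.val hW ω) ∧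
      ∀ k ω x, Θ.deriv hW k ω x = c * Φ.deriv hW k ω x := by
  refine ⟨⟨Φ.n, fun y => c * Φ.f y, Φ.smooth.const_mul c, Φ.h, Φ.memLp⟩, fun ω => rfl,
    fun k ω x => ?_⟩
  simp only [SmoothVar.deriv, partialDeriv_const_mul Φ.smooth.1, mul_assoc, Finset.mul_sum]
  rfl

theorem SmoothVar.exists_zero (hW : IsWiener T W P) :
    ∃ Θ : SmoothVar T, (∀ ω, Θ.val hW ω = 0) ∧ ∀ k ω x, Θ.deriv hW k ω x = 0 := by
  obtain ⟨Θ, h1, h2⟩ := SmoothVar.exists_smul 0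
    (⟨0, fun _ => 0, isCbInfty_zero, fun i => i.elim0, fun i => i.elim0⟩ : SmoothVar T) hW
  exact ⟨Θ, fun ω => by rw [h1, zero_mul], fun k ω x => by rw [h2, zero_mul]⟩

/-! ### The divergence of deterministic functions -/

/-- The graph of `Φ ↦ E[D^k Φ]`, as a subspace of `L²(Ω) × L²([0, T]^k)`. Smooth bounded random
variables come with a representation `f(I(h₁), …, I(hₙ))`, so that they do not form a vector space
themselves; their graph does. -/
def meanDerivGraph [IsProbabilityMeasure P] (hW : IsWiener T W P) (k : ℕ) :
    Submodule ℝ (Lp ℝ 2 P × Lp ℝ 2 (cubeMeasure T k)) where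
  carrier := {p | ∃ Φ : SmoothVar T,
    p = ((Φ.memLp_val hW).toLp (Φ.val hW), (Φ.memLp_meanDeriv hW k).toLp (Φ.meanDeriv hW k))}
  add_mem' := by
    rintro _ _ ⟨Φ, rfl⟩ ⟨Ψ, rfl⟩
    obtain ⟨Θ, h1, h2⟩ := SmoothVar.exists_add Φ Ψ hW
    refine ⟨Θ, Prod.ext ?_ ?_⟩
    · refine ((Φ.memLp_val hW).toLp_add (Ψ.memLp_val hW)).symm.trans
        (MemLp.toLp_congr _ (Θ.memLp_val hW) ?_)
      exact Filter.Eventually.of_forall fun ω => (h1 ω).symm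
    · refine ((Φ.memLp_meanDeriv hW k).toLp_add (Ψ.memLp_meanDeriv hW k)).symm.trans
        (MemLp.toLp_congr _ (Θ.memLp_meanDeriv hW k) ?_)
      refine Filter.Eventually.of_forall fun x => ?_
      simp only [SmoothVar.meanDeriv, h2, Pi.add_apply]
      exact (integral_add ((Φ.memLp_top_deriv hW k x).integrable le_top)
        ((Ψ.memLp_top_deriv hW k x).integrable le_top)).symm
  zero_mem' := by
    obtain ⟨Θ, h1, h2⟩ := SmoothVar.exists_zero (T := T) hW
    refine ⟨Θ, Prod.ext ?_ ?_⟩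
    · refine ((Lp.eq_zero_iff_ae_eq_zero).2 ((Θ.memLp_val hW).coeFn_toLp.trans ?_)).symm
      exact Filter.Eventually.of_forall h1
    · refine ((Lp.eq_zero_iff_ae_eq_zero).2 ((Θ.memLp_meanDeriv hW k).coeFn_toLp.trans ?_)).symm
      exact Filter.Eventually.of_forall fun x => by simp [SmoothVar.meanDeriv, h2]
  smul_mem' := by
    rintro c _ ⟨Φ, rfl⟩
    obtain ⟨Θ, h1, h2⟩ := SmoothVar.exists_smul c Φ hW
    refine ⟨Θ, Prod.ext ?_ ?_⟩
    · refine ((Φ.memLp_val hW).toLp_const_smul c).symm.trans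
        (MemLp.toLp_congr _ (Θ.memLp_val hW) ?_)
      exact Filter.Eventually.of_forall fun ω => (h1 ω).symm
    · refine ((Φ.memLp_meanDeriv hW k).toLp_const_smul c).symm.trans
        (MemLp.toLp_congr _ (Θ.memLp_meanDeriv hW k) ?_)
      refine Filter.Eventually.of_forall fun x => ?_
      simp only [SmoothVar.meanDeriv, h2, Pi.smul_apply, smul_eq_mul]
      exact (integral_const_mul _ _).symm

/-- On deterministic square integrable functions the divergence `δ^k` is a bounded operator with
values in `L²(Ω)`: the adjoint of `Φ ↦ E[D^k Φ]`. -/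
theorem exists_clm_isDivergence (hT : 0 < T) (hW : IsWiener T W P) (hgen : IsGeneratedBy W P)
    (k : ℕ) :
    ∃ δ : Lp ℝ 2 (cubeMeasure T k) →L[ℝ] Lp ℝ 2 P,
      ∀ (v : (Fin k → Time T) → ℝ) (hv : MemLp v 2 (cubeMeasure T k)),
        IsDivergence hW (fun _ => v) (δ (hv.toLp v)) := by
  have := hW.isProbabilityMeasure hT
  let S := meanDerivGraph hW k
  let e : S →ₗ[ℝ] Lp ℝ 2 P := (LinearMap.fst ℝ _ _).comp S.subtype
  let f : S →ₗ[ℝ] Lp ℝ 2 (cubeMeasure T k) := (LinearMap.snd ℝ _ _).comp S.subtype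
  have hdense : DenseRange e := by
    have h1 : (LinearMap.range e).topologicalClosure = ⊤ := by
      rw [Submodule.topologicalClosure_eq_top_iff, Submodule.eq_bot_iff]
      intro G hG
      refine eq_zero_of_forall_integral_val_mul_eq_zero hT hW hgen fun Φ => ?_
      have h2 := (Submodule.mem_orthogonal _ _).1 hG ((Φ.memLp_val hW).toLp (Φ.val hW))
        ⟨⟨_, Φ, rfl⟩, rfl⟩
      rw [← h2]
      have h3 := inner_toLp (Φ.memLp_val hW) (Lp.memLp G)
      rw [Lp.toLp_coeFn] at h3
      exact h3.symm
    rw [DenseRange, ← LinearMap.coe_range]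
    exact (Submodule.dense_iff_topologicalClosure_eq_top).2 h1
  obtain ⟨C, hC0, hC⟩ := exists_abs_integral_mul_meanDeriv_le hT hW k
  have hbound : ∃ C, ∀ x, ‖f x‖ ≤ C * ‖e x‖ := by
    refine ⟨C, ?_⟩
    rintro ⟨_, Φ, rfl⟩
    have h1 := hC Φ _ (Φ.memLp_meanDeriv hW k)
    rw [← norm_toLp_eq_sqrt (Φ.memLp_val hW), ← inner_toLp (Φ.memLp_meanDeriv hW k)
      (Φ.memLp_meanDeriv hW k), real_inner_self_eq_norm_mul_norm, abs_mul_self] at h1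
    change ‖(Φ.memLp_meanDeriv hW k).toLp _‖ ≤ C * ‖(Φ.memLp_val hW).toLp _‖
    rcases (norm_nonneg ((Φ.memLp_meanDeriv hW k).toLp _)).eq_or_lt with h | h
    · rw [← h]
      positivity
    · refine le_of_mul_le_mul_left ?_ h
      rw [← mul_assoc, mul_comm _ C]
      exact h1
  -- `D` is the continuous extension of `Φ ↦ E[D^k Φ]` to `L²(Ω)`.
  let D := f.extendOfNorm e
  refine ⟨ContinuousLinearMap.adjoint D, fun v hv Φ => ?_⟩
  have h1 := inner_toLp (Φ.memLp_val hW) (Lp.memLp (ContinuousLinearMap.adjoint D (hv.toLp v)))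
  rw [Lp.toLp_coeFn, ContinuousLinearMap.adjoint_inner_right] at h1
  have h2 : D ((Φ.memLp_val hW).toLp (Φ.val hW)) = (Φ.memLp_meanDeriv hW k).toLp _ :=
    LinearMap.extendOfNorm_eq hdense hbound (⟨_, Φ, rfl⟩ : S)
  rw [← h1, h2, inner_toLp, pairing_const_eq_integral_mul_meanDeriv hW hv]
  simp only [mul_comm]

/-- A square integrable `v` with a candidate for `δ^k(v)` in `L²(Ω)` is in the domain of `δ^k`. -/
theorem IsDivergence.memDomDivergence [IsProbabilityMeasure P] {hW : IsWiener T W P} {k : ℕ}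
    {v : Ω → (Fin k → Time T) → ℝ} {G : Lp ℝ 2 P} (hG : IsDivergence hW v G)
    (hv : MemLp (fun z : Ω × (Fin k → Time T) => v z.1 z.2) 2 (P.prod (cubeMeasure T k))) :
    MemDomDivergence hW v := by
  -- The summand `1` keeps the constant positive when `G = 0`.
  refine ⟨hv, ‖G‖ + 1, by positivity, fun Φ => ?_⟩
  rw [← hG Φ]
  have h1 := abs_real_inner_le_norm ((Φ.memLp_val hW).toLp (Φ.val hW)) G
  have h2 := inner_toLp (Φ.memLp_val hW) (Lp.memLp G)
  rw [Lp.toLp_coeFn] at h2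
  rw [h2, Lp.norm_toLp] at h1
  refine h1.trans ?_
  rw [mul_comm]
  exact mul_le_mul_of_nonneg_right (by linarith) ENNReal.toReal_nonneg

/-- The defining relation determines the divergence, as smooth bounded random variables are
dense. -/
theorem IsDivergence.divergence_eq (hT : 0 < T) {hW : IsWiener T W P} (hgen : IsGeneratedBy W P)
    {k : ℕ} {v : Ω → (Fin k → Time T) → ℝ} {G : Lp ℝ 2 P} (hG : IsDivergence hW v G)
    (hv : MemDomDivergence hW v) : divergence hW v = G := by
  have := hW.isProbabilityMeasure hT
  have hex : MemDomDivergence hW v ∧ ∃ G : Lp ℝ 2 P, IsDivergence hW v G := ⟨hv, G, hG⟩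
  rw [divergence, dif_pos hex]
  set G' := hex.2.choose with hG'
  have hspec : IsDivergence hW v G' := hex.2.choose_spec
  rw [← sub_eq_zero]
  refine eq_zero_of_forall_integral_val_mul_eq_zero hT hW hgen fun Φ => ?_
  have h1 := inner_toLp (Φ.memLp_val hW) (Lp.memLp (G' - G))
  have h2 := inner_toLp (Φ.memLp_val hW) (Lp.memLp G')
  have h3 := inner_toLp (Φ.memLp_val hW) (Lp.memLp G)
  rw [Lp.toLp_coeFn] at h1 h2 h3
  rw [← h1, inner_sub_right, h2, h3, hspec Φ, hG Φ, sub_self]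

/-! ### The inverse Leibniz formula -/

/-- The multiset of values of a finite sequence of indices. -/
def indexMultiset {ι : Type*} {k : ℕ} (i : Fin k → ι) : Multiset ι :=
  (List.ofFn i : Multiset ι)

theorem indexMultiset_cons {ι : Type*} {k : ℕ} (r : ι) (i : Fin k → ι) :
    indexMultiset (Fin.cons r i : Fin (k + 1) → ι) = r ::ₘ indexMultiset i := by
  rw [indexMultiset, List.ofFn_cons]
  rfl

theorem indexMultiset_append {ι : Type*} {m l : ℕ} (i : Fin m → ι) (j : Fin l → ι) :
    indexMultiset (Fin.append i j) = indexMultiset i + indexMultiset j := by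
  rw [indexMultiset, List.ofFn_fin_append]
  rfl

theorem indexMultiset_snoc {ι : Type*} {k : ℕ} (i : Fin k → ι) (r : ι) :
    indexMultiset (Fin.snoc i r : Fin (k + 1) → ι) = r ::ₘ indexMultiset i := by
  rw [indexMultiset, List.ofFn_succ']
  simp only [Fin.snoc_castSucc, Fin.snoc_last, List.concat_eq_append]
  rw [← Multiset.coe_add, add_comm]
  rfl

/-- A symmetric function of `k` indices is a function of the multiset of its indices. -/
theorem exists_eq_indexMultiset {n k : ℕ} {a : (Fin k → Fin n) → ℝ}
    (ha : ∀ (σ : Equiv.Perm (Fin k)) i, a (i ∘ σ) = a i) :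
    ∃ α : Multiset (Fin n) → ℝ, ∀ i, α (indexMultiset i) = a i := by
  classical
  -- Sequences with the same multiset of values agree after sorting.
  have key : ∀ i i' : Fin k → Fin n, indexMultiset i = indexMultiset i' → a i = a i' := by
    intro i i' h
    have hp : (List.ofFn i).Perm (List.ofFn i') := Multiset.coe_eq_coe.1 h
    have hs : i ∘ Tuple.sort i = i' ∘ Tuple.sort i' :=
      List.ofFn_injective
        ((((Tuple.sort i).ofFn_comp_perm i).trans
          (hp.trans ((Tuple.sort i').ofFn_comp_perm i').symm)).eq_of_pairwise'
          (Tuple.monotone_sort i).sortedLE_ofFn.pairwise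
          (Tuple.monotone_sort i').sortedLE_ofFn.pairwise)
    rw [← ha (Tuple.sort i) i, hs, ha]
  -- The value `0` at multisets of another cardinality plays no role.
  refine ⟨fun s => if h : ∃ i : Fin k → Fin n, indexMultiset i = s then a h.choose else 0,
    fun i => ?_⟩
  have h : ∃ i' : Fin k → Fin n, indexMultiset i' = indexMultiset i := ⟨i, rfl⟩
  simp only [dif_pos h]
  exact key _ _ h.choose_spec

/-- The contraction `∑_{i, j} α(i, j) ∂_i (f ∂_j g)` over index sequences `i` and `j` of lengths `m`
and `l`, for symmetric coefficients `α`. -/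
noncomputable def leibnizTerm {n : ℕ} (α : Multiset (Fin n) → ℝ) (f g : (Fin n → ℝ) → ℝ) (m l : ℕ)
    (y : Fin n → ℝ) : ℝ :=
  ∑ i : Fin m → Fin n, ∑ j : Fin l → Fin n,
    α (indexMultiset i + indexMultiset j) * partialDeriv (fun z => f z * partialDeriv g j z) i y

/-- The product rule `∂_i(∂_r f ∂_j g) = ∂_i ∂_r(f ∂_j g) - ∂_i(f ∂_r ∂_j g)`, summed against
symmetric coefficients. Symmetry allows the index `r` to be moved from one sequence of indices to
the other. -/
theorem sum_leibnizTerm_cons {n : ℕ} (α : Multiset (Fin n) → ℝ) {f g : (Fin n → ℝ) → ℝ}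
    (hf : ContDiff ℝ (⊤ : ℕ∞) f) (hg : ContDiff ℝ (⊤ : ℕ∞) g) (m l : ℕ) (y : Fin n → ℝ) :
    ∑ r, leibnizTerm (fun s => α (r ::ₘ s)) (partialDeriv f fun _ : Fin 1 => r) g m l y
      = leibnizTerm α f g (m + 1) l y - leibnizTerm α f g m (l + 1) y := by
  have h1 : leibnizTerm α f g (m + 1) l y = ∑ r, ∑ i : Fin m → Fin n, ∑ j : Fin l → Fin n,
      α (r ::ₘ (indexMultiset i + indexMultiset j))
        * (partialDeriv (fun z => partialDeriv f (fun _ : Fin 1 => r) z * partialDeriv g j z) i y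
          + partialDeriv (fun z => f z * partialDeriv g (Fin.cons r j : Fin (l + 1) → Fin n) z)
            i y) := by
    rw [leibnizTerm, ← (Fin.snocEquiv fun _ : Fin (m + 1) => Fin n).sum_comp,
      Fintype.sum_prod_type]
    refine Finset.sum_congr rfl fun r _ => Finset.sum_congr rfl fun i _ =>
      Finset.sum_congr rfl fun j _ => ?_
    have hgj := contDiff_partialDeriv hg j
    change α (indexMultiset (Fin.snoc i r : Fin (m + 1) → Fin n) + indexMultiset j)
      * partialDeriv _ (Fin.snoc i r : Fin (m + 1) → Fin n) y = _
    rw [indexMultiset_snoc, Multiset.cons_add, partialDeriv_snoc (hf.mul hgj),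
      partialDeriv_cons hg, ← partialDeriv_add ((contDiff_partialDeriv hf _).mul hgj)
        (hf.mul (contDiff_partialDeriv hgj _))]
    congr 2
    funext z
    exact partialDeriv_mul_one hf hgj r z
  have h2 : leibnizTerm α f g m (l + 1) y = ∑ r, ∑ i : Fin m → Fin n, ∑ j : Fin l → Fin n,
      α (r ::ₘ (indexMultiset i + indexMultiset j))
        * partialDeriv (fun z => f z * partialDeriv g (Fin.cons r j : Fin (l + 1) → Fin n) z)
            i y := by
    rw [leibnizTerm, Finset.sum_comm, ← (Fin.consEquiv fun _ : Fin (l + 1) => Fin n).sum_comp,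
      Fintype.sum_prod_type]
    refine Finset.sum_congr rfl fun r _ => ?_
    rw [Finset.sum_comm]
    refine Finset.sum_congr rfl fun i _ => Finset.sum_congr rfl fun j _ => ?_
    change α (indexMultiset i + indexMultiset (Fin.cons r j : Fin (l + 1) → Fin n)) * _ = _
    rw [indexMultiset_cons, Multiset.add_cons]
    rfl
  rw [h1, h2, ← Finset.sum_sub_distrib]
  refine Finset.sum_congr rfl fun r _ => ?_
  rw [leibnizTerm, ← Finset.sum_sub_distrib]
  refine Finset.sum_congr rfl fun i _ => ?_
  rw [← Finset.sum_sub_distrib]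
  refine Finset.sum_congr rfl fun j _ => ?_
  ring

/-- The inverse Leibniz formula `g ∂^k f = ∑_l (-1)^l (k choose l) ∂^{k-l} (f ∂^l g)`, contracted
with symmetric coefficients. -/
theorem sum_partialDeriv_mul_eq {n : ℕ} {g : (Fin n → ℝ) → ℝ} (hg : ContDiff ℝ (⊤ : ℕ∞) g)
    (y : Fin n → ℝ) (k : ℕ) (α : Multiset (Fin n) → ℝ) {f : (Fin n → ℝ) → ℝ}
    (hf : ContDiff ℝ (⊤ : ℕ∞) f) :
    ∑ i : Fin k → Fin n, α (indexMultiset i) * (partialDeriv f i y * g y)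
      = ∑ p ∈ Finset.HasAntidiagonal.antidiagonal k, (k.choose p.1 : ℝ)
        * ((-1) ^ p.1 * leibnizTerm α f g p.2 p.1 y) := by
  induction k generalizing α f with
  | zero => simp [leibnizTerm, partialDeriv_zero, indexMultiset]
  | succ k ih =>
    -- Set aside the innermost derivative `∂_r` of `f`, to use the induction hypothesis for `∂_r f`.
    have h1 : ∑ i : Fin (k + 1) → Fin n, α (indexMultiset i) * (partialDeriv f i y * g y)
        = ∑ r, ∑ i : Fin k → Fin n, α (r ::ₘ indexMultiset i)
          * (partialDeriv (partialDeriv f fun _ : Fin 1 => r) i y * g y) := by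
      rw [← (Fin.snocEquiv fun _ : Fin (k + 1) => Fin n).sum_comp, Fintype.sum_prod_type]
      refine Finset.sum_congr rfl fun r _ => Finset.sum_congr rfl fun i _ => ?_
      change α (indexMultiset (Fin.snoc i r : Fin (k + 1) → Fin n))
        * (partialDeriv f (Fin.snoc i r : Fin (k + 1) → Fin n) y * g y) = _
      rw [indexMultiset_snoc, partialDeriv_snoc hf]
    rw [h1, Finset.sum_congr rfl fun r _ =>
      ih (fun s => α (r ::ₘ s)) (contDiff_partialDeriv hf fun _ : Fin 1 => r), Finset.sum_comm,
      Finset.sum_antidiagonal_choose_succ_mul (fun l m => (-1) ^ l * leibnizTerm α f g m l y) k,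
      ← Finset.sum_add_distrib]
    refine Finset.sum_congr rfl fun p hp => ?_
    rw [← Finset.mul_sum, ← Finset.mul_sum, sum_leibnizTerm_cons α hf hg,
      Nat.choose_symm_of_eq_add (Finset.HasAntidiagonal.mem_antidiagonal.1 hp).symm]
    ring

/-! ### Sections of square integrable functions -/

/-- Weak measurability implies strong measurability in a separable Hilbert space. -/
theorem aestronglyMeasurable_of_forall_inner {E β : Type*} [NormedAddCommGroup E]
    [InnerProductSpace ℝ E] [CompleteSpace E] [SecondCountableTopology E] [MeasurableSpace β]
    {ν : Measure β} {s : β → E} (h : ∀ Y, AEMeasurable (fun b => inner ℝ Y (s b)) ν) :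
    AEStronglyMeasurable s ν := by
  -- The coordinates along a dense sequence embed `E` measurably into a countable product.
  borelize E
  let Θ : E → ℕ → ℝ := fun X n => inner ℝ (TopologicalSpace.denseSeq E n) X
  have hc : Continuous Θ := by
    refine continuous_pi fun n => ?_
    fun_prop
  have hinj : Function.Injective Θ := by
    intro X Y hXY
    have h1 : ∀ Z : E, inner ℝ Z X = inner ℝ Z Y := by
      intro Z
      refine (TopologicalSpace.denseRange_denseSeq E).induction_on
        (p := fun Z => inner ℝ Z X = inner ℝ Z Y) Z (isClosed_eq (by fun_prop) (by fun_prop))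
        fun n => congrFun hXY n
    exact ext_inner_left ℝ h1
  have hm : AEMeasurable (Θ ∘ s) ν := aemeasurable_pi_lambda _ fun n => h _
  exact ((hc.measurableEmbedding hinj).aemeasurable_comp_iff.1 hm).aestronglyMeasurable

/-- The sections `U(·, b)` of a square integrable function form a Bochner integrable function of
`b` with values in `L²`. -/
theorem exists_integrable_section {α β : Type*} [MeasurableSpace α] [MeasurableSpace β]
    {μ : Measure α} {ν : Measure β} [IsFiniteMeasure μ] [IsFiniteMeasure ν]
    [SecondCountableTopology (Lp ℝ 2 μ)] {U : α × β → ℝ} (hU : MemLp U 2 (μ.prod ν)) :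
    ∃ s : β → Lp ℝ 2 μ, Integrable s ν ∧
      ∀ᵐ b ∂ν, ∃ h : MemLp (fun a => U (a, b)) 2 μ, s b = h.toLp _ := by
  classical
  let s : β → Lp ℝ 2 μ := fun b =>
    if h : MemLp (fun a => U (a, b)) 2 μ then h.toLp _ else 0
  have hsq := hU.integrable_sq
  have hmem : ∀ᵐ b ∂ν, MemLp (fun a => U (a, b)) 2 μ := by
    filter_upwards [(hU.integrable (by norm_num)).prod_left_ae, hsq.prod_left_ae] with b h1 h2
    exact (memLp_two_iff_integrable_sq h1.1).2 h2
  have hs : ∀ b (h : MemLp (fun a => U (a, b)) 2 μ), s b = h.toLp _ := fun b h => dif_pos h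
  have haesm : AEStronglyMeasurable s ν := by
    refine aestronglyMeasurable_of_forall_inner fun Y => ?_
    have h1 : MemLp (fun p : α × β => Y p.1) 2 (μ.prod ν) := (Lp.memLp Y).comp_fst ν
    have h2 := (h1.integrable_mul hU).integral_prod_right
    refine h2.1.aemeasurable.congr ?_
    filter_upwards [hmem] with b hb
    have h3 := inner_toLp (Lp.memLp Y) hb
    rw [Lp.toLp_coeFn] at h3
    rw [hs b hb, h3]
    rfl
  refine ⟨s, ?_, hmem.mono fun b hb => ⟨hb, hs b hb⟩⟩
  have h2 : MemLp s 2 ν := by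
    rw [memLp_two_iff_integrable_sq_norm haesm]
    refine hsq.integral_prod_right.congr ?_
    filter_upwards [hmem] with b hb
    rw [hs b hb, norm_toLp_eq_sqrt, Real.sq_sqrt (integral_nonneg fun _ => sq_nonneg _)]
  exact h2.integrable (by norm_num)

/-! ### Permutations and blocks of variables -/

instance (k : ℕ) : SecondCountableTopology (Lp ℝ 2 (cubeMeasure T k)) := by
  have : Fact ((2 : ℝ≥0∞) ≠ ∞) := ⟨by norm_num⟩
  have : SFinite (cubeMeasure T k) := inferInstance
  have : IsSeparable (cubeMeasure T k) := inferInstance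
  infer_instance

theorem measurePreserving_comp_perm {k : ℕ} (σ : Equiv.Perm (Fin k)) :
    MeasurePreserving (fun (x : Fin k → Time T) i => x (σ i)) (cubeMeasure T k)
      (cubeMeasure T k) := by
  have h := measurePreserving_piCongrLeft (fun _ : Fin k => timeMeasure T) σ.symm
  have h1 : ⇑(MeasurableEquiv.piCongrLeft (fun _ : Fin k => Time T) σ.symm)
      = fun x i => x (σ i) := by
    funext x i
    obtain ⟨j, rfl⟩ := σ.symm.surjective i
    rw [MeasurableEquiv.coe_piCongrLeft, Equiv.piCongrLeft_apply_apply, Equiv.apply_symm_apply]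
  rwa [h1] at h

/-- Juxtaposition identifies `[0, T]^m × [0, T]^l` with `[0, T]^k` for `k = m + l`. -/
theorem measurePreserving_append {k m l : ℕ} (hk : k = m + l) :
    MeasurePreserving (fun (p : (Fin m → Time T) × (Fin l → Time T)) (i : Fin k) =>
        (Fin.append p.1 p.2 (Fin.cast hk i) : Time T))
      ((cubeMeasure T m).prod (cubeMeasure T l)) (cubeMeasure T k) := by
  subst hk
  have hm : Measurable (fun (p : (Fin m → Time T) × (Fin l → Time T)) (i : Fin (m + l)) =>
      (Fin.append p.1 p.2 (Fin.cast rfl i) : Time T)) := by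
    refine measurable_pi_lambda _ fun i => ?_
    refine Fin.addCases (fun j => ?_) (fun j => ?_) i
    · simp only [Fin.cast_eq_self, Fin.append_left]
      fun_prop
    · simp only [Fin.cast_eq_self, Fin.append_right]
      fun_prop
  refine ⟨hm, ?_⟩
  conv_rhs => rw [cubeMeasure]
  refine (Measure.pi_eq fun S hS => ?_).symm
  rw [Measure.map_apply hm (MeasurableSet.univ_pi hS)]
  have h1 : (fun (p : (Fin m → Time T) × (Fin l → Time T)) (i : Fin (m + l)) =>
      (Fin.append p.1 p.2 (Fin.cast rfl i) : Time T)) ⁻¹' Set.pi Set.univ S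
      = (Set.pi Set.univ fun i => S (Fin.castAdd l i))
        ×ˢ (Set.pi Set.univ fun i => S (Fin.natAdd m i)) := by
    ext p
    simp only [Set.mem_preimage, Set.mem_pi, Set.mem_univ, true_implies, Set.mem_prod,
      Fin.cast_eq_self]
    refine ⟨fun h => ⟨fun i => ?_, fun i => ?_⟩, fun h i => ?_⟩
    · simpa using h (Fin.castAdd l i)
    · simpa using h (Fin.natAdd m i)
    · refine Fin.addCases (fun j => ?_) (fun j => ?_) i
      · simpa using h.1 j
      · simpa using h.2 j
  rw [h1, Measure.prod_prod, cubeMeasure, cubeMeasure, Measure.pi_pi, Measure.pi_pi,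
    Fin.prod_univ_add]

theorem prod_append {ι X : Type*} (h : ι → X → ℝ) {k m l : ℕ} (hk : k = m + l) (i : Fin m → ι)
    (j : Fin l → ι) (y : Fin m → X) (x : Fin l → X) :
    ∏ p : Fin k, h (Fin.append i j (Fin.cast hk p)) (Fin.append y x (Fin.cast hk p))
      = (∏ p, h (i p) (y p)) * ∏ q, h (j q) (x q) := by
  subst hk
  simp [Fin.prod_univ_add]

/-- Integration over `[0, T]^k` against a tensor product, carried out in two blocks of variables. -/
theorem integral_mul_tensor_append {ι : Type*} {h : ι → Time T → ℝ}
    (hL : ∀ i, MemLp (h i) 2 (timeMeasure T)) {k m l : ℕ} (hk : k = m + l)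
    {u : (Fin k → Time T) → ℝ} (hu : MemLp u 2 (cubeMeasure T k)) (i : Fin m → ι)
    (j : Fin l → ι) :
    Integrable (fun x : Fin l → Time T => (∏ q, h (j q) (x q)) *
        ∫ y, u (fun p => Fin.append y x (Fin.cast hk p)) * ∏ p, h (i p) (y p) ∂(cubeMeasure T m))
      (cubeMeasure T l) ∧
    ∫ x, (∏ q, h (j q) (x q)) *
        ∫ y, u (fun p => Fin.append y x (Fin.cast hk p)) * ∏ p, h (i p) (y p) ∂(cubeMeasure T m)
      ∂(cubeMeasure T l)
      = ∫ z, u z * ∏ p, h (Fin.append i j (Fin.cast hk p)) (z p) ∂(cubeMeasure T k) := by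
  have hmp := measurePreserving_append (T := T) hk
  have hten := memLp_tensor hL fun p => Fin.append i j (Fin.cast hk p)
  have hint : Integrable (fun z => u z * ∏ p, h (Fin.append i j (Fin.cast hk p)) (z p))
      (cubeMeasure T k) := hu.integrable_mul hten
  have hint2 : Integrable (fun p : (Fin m → Time T) × (Fin l → Time T) =>
      u (fun q => Fin.append p.1 p.2 (Fin.cast hk q))
        * ((∏ q, h (i q) (p.1 q)) * ∏ q, h (j q) (p.2 q)))
      ((cubeMeasure T m).prod (cubeMeasure T l)) := by
    have h1 := hmp.integrable_comp_of_integrable hint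
    refine h1.congr (Filter.Eventually.of_forall fun p => ?_)
    simp only [Function.comp_apply]
    rw [prod_append]
  have hx : ∀ x : Fin l → Time T, (∏ q, h (j q) (x q)) *
        ∫ y, u (fun p => Fin.append y x (Fin.cast hk p)) * ∏ p, h (i p) (y p) ∂(cubeMeasure T m)
      = ∫ y, u (fun q => Fin.append y x (Fin.cast hk q))
        * ((∏ q, h (i q) (y q)) * ∏ q, h (j q) (x q)) ∂(cubeMeasure T m) := by
    intro x
    rw [← integral_const_mul]
    congr 1
    funext y
    ring
  simp only [hx]
  refine ⟨hint2.integral_prod_right, ?_⟩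
  rw [← integral_comp_of_measurePreserving hmp hint.1, ← integral_prod_symm _ hint2]
  congr 1
  funext p
  rw [prod_append]

theorem memLp_prod_of_memLp [IsProbabilityMeasure P] {k : ℕ} {v : (Fin k → Time T) → ℝ}
    (hv : MemLp v 2 (cubeMeasure T k)) :
    MemLp (fun z : Ω × (Fin k → Time T) => v z.2) 2 (P.prod (cubeMeasure T k)) :=
  hv.comp_measurePreserving measurePreserving_snd

/-! ### The expansion of the divergence -/

/-- For almost every `x` the section `u(•, x)` lies in the domain of the divergence, and its
divergence is a Bochner integrable function of `x`. -/
theorem exists_integrable_divergence_section (hT : 0 < T) (hW : IsWiener T W P)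
    (hgen : IsGeneratedBy W P) {k : ℕ} {u : (Fin k → Time T) → ℝ}
    (hu : MemLp u 2 (cubeMeasure T k)) (ℓ : Fin (k + 1)) :
    Integrable (fun x => divergence hW (fun _ : Ω => sectionAt u ℓ x)) (cubeMeasure T ℓ) ∧
    ∀ᵐ x ∂(cubeMeasure T ℓ), MemLp (sectionAt u ℓ x) 2 (cubeMeasure T (k - ℓ)) ∧
      MemDomDivergence hW (fun _ : Ω => sectionAt u ℓ x) ∧
      IsDivergence hW (fun _ => sectionAt u ℓ x)
        (divergence hW (fun _ : Ω => sectionAt u ℓ x)) := by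
  have := hW.isProbabilityMeasure hT
  obtain ⟨δ, hδ⟩ := exists_clm_isDivergence hT hW hgen (k - ℓ)
  have hmp := measurePreserving_append (T := T)
    (Nat.sub_add_cancel (Nat.le_of_lt_succ ℓ.2)).symm
  obtain ⟨s, hs, hsec⟩ := exists_integrable_section (hu.comp_measurePreserving hmp)
  have key : ∀ᵐ x ∂(cubeMeasure T ℓ), MemLp (sectionAt u ℓ x) 2 (cubeMeasure T (k - ℓ)) ∧
      MemDomDivergence hW (fun _ : Ω => sectionAt u ℓ x) ∧
      IsDivergence hW (fun _ => sectionAt u ℓ x) (δ (s x)) ∧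
      divergence hW (fun _ : Ω => sectionAt u ℓ x) = δ (s x) := by
    filter_upwards [hsec] with x hx
    obtain ⟨h1, h2⟩ := hx
    have h3 : MemLp (sectionAt u ℓ x) 2 (cubeMeasure T (k - ℓ)) := h1
    have h4 : IsDivergence hW (fun _ => sectionAt u ℓ x) (δ (s x)) := by
      rw [h2]
      exact hδ _ h3
    have h5 := h4.memDomDivergence (memLp_prod_of_memLp h3)
    exact ⟨h3, h5, h4, h4.divergence_eq hT hgen h5⟩
  refine ⟨(δ.integrable_comp hs).congr ?_, ?_⟩
  · filter_upwards [key] with x hx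
    exact hx.2.2.2.symm
  · filter_upwards [key] with x hx
    refine ⟨hx.1, hx.2.1, ?_⟩
    rw [hx.2.2.2]
    exact hx.2.2.1

theorem integrable_expansionTerm (hT : 0 < T) (hW : IsWiener T W P)
    (hgen : IsGeneratedBy W P) {k : ℕ} {F : SmoothVar T} (hF : ∀ i, Continuous (F.h i))
    {u : (Fin k → Time T) → ℝ} (hu : MemLp u 2 (cubeMeasure T k)) (ℓ : Fin (k + 1)) :
    Integrable (expansionTerm hW F u ℓ) (cubeMeasure T ℓ) := by
  have := hW.isProbabilityMeasure hT
  obtain ⟨hint, -⟩ := exists_integrable_divergence_section hT hW hgen hu ℓ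
  -- Multiplication by the bounded random variable `∂_j f(V)` is a bounded operator on `L²(Ω)`, and
  -- the remaining factor is a continuous function on a compact set.
  let φ : (Fin ℓ → Fin F.n) → Lp ℝ ∞ P := fun j =>
    (F.memLp_top_comp_vec hW (F.smooth.partialDeriv j)).toLp _
  let M : (Fin ℓ → Fin F.n) → Lp ℝ 2 P →L[ℝ] Lp ℝ 2 P := fun j =>
    (ContinuousLinearMap.mul ℝ ℝ).holderL P ∞ 2 2 (φ j)
  have hM : ∀ j (X : Lp ℝ 2 P), M j X =ᵐ[P] fun ω => partialDeriv F.f j (F.vec hW ω) * X ω := by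
    intro j X
    have h1 := (ContinuousLinearMap.mul ℝ ℝ).coeFn_holder (r := 2) (φ j) X
    filter_upwards [h1, (F.memLp_top_comp_vec hW (F.smooth.partialDeriv j)).coeFn_toLp] with ω h2 h3
    refine h2.trans ?_
    simp only [φ, h3, ContinuousLinearMap.mul_apply']
  have hterm : expansionTerm hW F u ℓ = fun x => ∑ j : Fin ℓ → Fin F.n,
      (∏ q, F.h (j q) (x q)) • M j (divergence hW (fun _ : Ω => sectionAt u ℓ x)) := by
    funext x
    refine Lp.ext ?_
    set X := divergence hW (fun _ : Ω => sectionAt u ℓ x) with hX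
    have h1 : ∀ᵐ ω ∂P, ∀ j, ((∏ q, F.h (j q) (x q)) • M j X) ω
        = (∏ q, F.h (j q) (x q)) * (partialDeriv F.f j (F.vec hW ω) * X ω) := by
      rw [ae_all_iff]
      intro j
      filter_upwards [hM j X, Lp.coeFn_smul (∏ q, F.h (j q) (x q)) (M j X)] with ω h2 h3
      rw [h3, Pi.smul_apply, h2, smul_eq_mul]
    refine (MemLp.coeFn_toLp _).trans (Filter.EventuallyEq.symm ?_)
    refine (Lp.coeFn_finsetSum (μ := P) _ fun j => (∏ q, F.h (j q) (x q)) • M j X).trans ?_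
    filter_upwards [h1] with ω h2
    rw [Finset.sum_apply, Finset.sum_congr rfl fun j _ => h2 j, SmoothVar.deriv, Finset.sum_mul]
    refine Finset.sum_congr rfl fun j _ => ?_
    ring
  rw [hterm]
  refine integrable_finsetSum _ fun j _ => ?_
  have hc : Continuous fun x : Fin ℓ → Time T => ∏ q, F.h (j q) (x q) :=
    continuous_finsetProd _ fun q _ => (hF (j q)).comp (continuous_apply q)
  obtain ⟨C, hC⟩ := isCompact_univ.exists_bound_of_continuousOn hc.continuousOn
  exact ((M j).integrable_comp hint).bdd_smul C hc.aestronglyMeasurable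
    (Filter.Eventually.of_forall fun x => hC x (Set.mem_univ x))

/-- For `Φ` and `F` given by functions of the same vector of Wiener-Itô integrals, the product
`Φ · (D^l F)(x)` is a smooth bounded random variable, and its pairing with a deterministic function
is computed. -/
theorem exists_smoothVar_mul_deriv [IsProbabilityMeasure P] (hW : IsWiener T W P) {n : ℕ}
    {h : Fin n → Time T → ℝ} (hL : ∀ i, MemLp (h i) 2 (timeMeasure T)) {f g : (Fin n → ℝ) → ℝ}
    (hf : IsCbInfty f) (hg : IsCbInfty g) (l : ℕ) (x : Fin l → Time T) :
    ∃ Ψ : SmoothVar T,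
      (∀ ω, Ψ.val hW ω = (⟨n, f, hf, h, hL⟩ : SmoothVar T).val hW ω
        * (⟨n, g, hg, h, hL⟩ : SmoothVar T).deriv hW l ω x) ∧
      ∀ (m : ℕ) (v : (Fin m → Time T) → ℝ), MemLp v 2 (cubeMeasure T m) →
        pairing hW (fun _ => v) Ψ = ∑ i : Fin m → Fin n, ∑ j : Fin l → Fin n,
          (∫ ω, partialDeriv (fun z => f z * partialDeriv g j z) i
            ((⟨n, f, hf, h, hL⟩ : SmoothVar T).vec hW ω) ∂P)
          * ((∏ q, h (j q) (x q)) * ∫ y, v y * ∏ p, h (i p) (y p) ∂(cubeMeasure T m)) := by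
  have hs : IsCbInfty fun z => ∑ j : Fin l → Fin n,
      (∏ q, h (j q) (x q)) * (f z * partialDeriv g j z) :=
    IsCbInfty.sum _ fun j => (hf.mul (hg.partialDeriv j)).const_mul _
  refine ⟨⟨n, _, hs, h, hL⟩, fun ω => ?_, fun m v hv => ?_⟩
  · change ∑ j : Fin l → Fin n, _ = _ * ∑ j : Fin l → Fin n, _
    rw [Finset.mul_sum]
    refine Finset.sum_congr rfl fun j _ => ?_
    change _ * (f _ * partialDeriv g j _) = f _ * (partialDeriv g j _ * _)
    ring_nf
    rfl
  · set Φ : SmoothVar T := ⟨n, f, hf, h, hL⟩ with hΦ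
    set Ψ : SmoothVar T := ⟨n, _, hs, h, hL⟩ with hΨ
    rw [pairing_const_eq_integral_mul_meanDeriv hW hv]
    have hpd : ∀ (i : Fin m → Fin n) (z : Fin n → ℝ), partialDeriv Ψ.f i z
        = ∑ j : Fin l → Fin n, (∏ q, h (j q) (x q))
          * partialDeriv (fun z => f z * partialDeriv g j z) i z := by
      intro i z
      have h1 := fun j : Fin l → Fin n => (hf.mul (hg.partialDeriv j)).1
      refine (partialDeriv_sum _ (fun j => contDiff_const.mul (h1 j)) i z).trans ?_
      exact Finset.sum_congr rfl fun j _ => partialDeriv_const_mul (h1 j) _ i z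
    have hmean : ∀ i : Fin m → Fin n, ∫ ω, partialDeriv Ψ.f i (Ψ.vec hW ω) ∂P
        = ∑ j : Fin l → Fin n, (∏ q, h (j q) (x q))
          * ∫ ω, partialDeriv (fun z => f z * partialDeriv g j z) i (Φ.vec hW ω) ∂P := by
      intro i
      simp only [hpd]
      rw [integral_finsetSum]
      · simp only [integral_const_mul]
        rfl
      · intro j _
        exact ((Φ.memLp_top_comp_vec hW ((hf.mul (hg.partialDeriv j)).partialDeriv i)).integrable
          le_top).const_mul _
    have hint : ∀ i : Fin m → Fin n, Integrable (fun y => v y * ∏ p, h (i p) (y p))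
        (cubeMeasure T m) := fun i => hv.integrable_mul (memLp_tensor hL i)
    have hx : ∀ y, v y * Ψ.meanDeriv hW m y = ∑ i : Fin m → Fin n,
        (∫ ω, partialDeriv Ψ.f i (Ψ.vec hW ω) ∂P) * (v y * ∏ p, h (i p) (y p)) := by
      intro y
      rw [SmoothVar.meanDeriv_eq_sum, Finset.mul_sum]
      refine Finset.sum_congr rfl fun i _ => ?_
      exact mul_left_comm _ _ _
    simp only [hx]
    rw [integral_finsetSum _ fun i _ => (hint i).const_mul _]
    refine Finset.sum_congr rfl fun i _ => ?_
    rw [integral_const_mul, hmean, Finset.sum_mul]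
    refine Finset.sum_congr rfl fun j _ => ?_
    ring

/-- The right-hand side of the expansion satisfies the defining relation of `δ^k(F u)`. Pairing the
term of index `l` with `Φ` gives the mean of a contraction of `∂^{k-l} (f ∂^l g)` with the
coefficients of `u`, and the inverse Leibniz formula sums these up to the pairing with `F u`. -/
theorem isDivergence_sum_expansionTerm (hT : 0 < T) (hW : IsWiener T W P)
    (hgen : IsGeneratedBy W P) {k : ℕ} {F : SmoothVar T} (hF : ∀ i, Continuous (F.h i))
    {u : (Fin k → Time T) → ℝ} (hu : MemLp u 2 (cubeMeasure T k))
    (hsymm : ∀ σ : Equiv.Perm (Fin k), ∀ᵐ x ∂(cubeMeasure T k), u (fun i => x (σ i)) = u x) :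
    IsDivergence hW (fun ω x => F.val hW ω * u x)
      (∑ ℓ : Fin (k + 1), ((-1 : ℝ) ^ (ℓ : ℕ) * (k.choose ℓ : ℝ)) •
        ∫ x, expansionTerm hW F u ℓ x ∂(cubeMeasure T ℓ)) := by
  have := hW.isProbabilityMeasure hT
  intro Φ
  obtain ⟨n, h, hL, f, g, hf, hg, e1, e2, e3, e4⟩ := SmoothVar.exists_common Φ F hW
  set Φ' : SmoothVar T := ⟨n, f, hf, h, hL⟩ with hΦ'
  set F' : SmoothVar T := ⟨n, g, hg, h, hL⟩ with hF'
  let V : Ω → Fin n → ℝ := Φ'.vec hW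
  -- The coefficients of `u` along the tensor products of the integrands.
  let a : (Fin k → Fin n) → ℝ := fun i => ∫ x, u x * ∏ p, h (i p) (x p) ∂(cubeMeasure T k)
  have hten : ∀ {m : ℕ} (i : Fin m → Fin n), MemLp (fun x : Fin m → Time T => ∏ p, h (i p) (x p)) 2
      (cubeMeasure T m) := fun i => memLp_tensor hL i
  have hasymm : ∀ (σ : Equiv.Perm (Fin k)) i, a (i ∘ σ) = a i := by
    intro σ i
    have h1 : AEStronglyMeasurable (fun x => u x * ∏ p, h ((i ∘ σ) p) (x p)) (cubeMeasure T k) :=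
      hu.1.mul (hten _).1
    change ∫ x, u x * ∏ p, h ((i ∘ σ) p) (x p) ∂(cubeMeasure T k) = _
    rw [← integral_comp_of_measurePreserving (measurePreserving_comp_perm σ) h1]
    refine integral_congr_ae ?_
    filter_upwards [hsymm σ] with x hx
    rw [hx]
    congr 1
    exact Equiv.prod_comp σ fun p => h (i p) (x p)
  obtain ⟨α, hα⟩ := exists_eq_indexMultiset hasymm
  let E : ∀ {m l : ℕ}, (Fin m → Fin n) → (Fin l → Fin n) → ℝ := fun i j =>
    ∫ ω, partialDeriv (fun z => f z * partialDeriv g j z) i (V ω) ∂P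
  have hEi : ∀ {m l : ℕ} (i : Fin m → Fin n) (j : Fin l → Fin n),
      Integrable (fun ω => partialDeriv (fun z => f z * partialDeriv g j z) i (V ω)) P :=
    fun i j => (Φ'.memLp_top_comp_vec hW ((hf.mul (hg.partialDeriv j)).partialDeriv i)).integrable
      le_top
  -- The pairing with the right-hand side, term by term.
  have hterm : ∀ ℓ : Fin (k + 1), ∫ x, inner ℝ ((Φ.memLp_val hW).toLp (Φ.val hW))
      (expansionTerm hW F u ℓ x) ∂(cubeMeasure T ℓ)
      = ∑ i : Fin (k - ℓ) → Fin n, ∑ j : Fin ℓ → Fin n,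
        α (indexMultiset i + indexMultiset j) * E i j := by
    intro ℓ
    have hk : k = k - ℓ + ℓ := (Nat.sub_add_cancel (Nat.le_of_lt_succ ℓ.2)).symm
    obtain ⟨-, hsec⟩ := exists_integrable_divergence_section hT hW hgen hu ℓ
    have h1 : ∀ᵐ x ∂(cubeMeasure T ℓ), inner ℝ ((Φ.memLp_val hW).toLp (Φ.val hW))
        (expansionTerm hW F u ℓ x) = ∑ i : Fin (k - ℓ) → Fin n, ∑ j : Fin ℓ → Fin n,
          E i j * ((∏ q, h (j q) (x q)) * ∫ y, u (fun p => Fin.append y x (Fin.cast hk p))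
            * ∏ p, h (i p) (y p) ∂(cubeMeasure T (k - ℓ))) := by
      filter_upwards [hsec] with x hx
      obtain ⟨hx1, -, hx2⟩ := hx
      obtain ⟨Ψ, hΨ1, hΨ2⟩ := exists_smoothVar_mul_deriv hW hL hf hg ℓ x
      have h2 := (hx2 Ψ).trans (hΨ2 _ _ hx1)
      refine Eq.trans ?_ h2
      rw [expansionTerm, inner_toLp]
      refine integral_congr_ae (Filter.Eventually.of_forall fun ω => ?_)
      simp only
      rw [hΨ1, ← e1, ← e4]
      ring
    rw [integral_congr_ae h1]
    have h3 := fun (i : Fin (k - ℓ) → Fin n) (j : Fin ℓ → Fin n) =>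
      integral_mul_tensor_append hL hk hu i j
    rw [integral_finsetSum _ fun i _ => integrable_finsetSum _ fun j _ => (h3 i j).1.const_mul _]
    refine Finset.sum_congr rfl fun i _ => ?_
    rw [integral_finsetSum _ fun j _ => (h3 i j).1.const_mul _]
    refine Finset.sum_congr rfl fun j _ => ?_
    rw [integral_const_mul, (h3 i j).2, mul_comm, ← indexMultiset_append]
    congr 1
    have h4 : indexMultiset (Fin.append i j)
        = indexMultiset fun p : Fin k => Fin.append i j (Fin.cast hk p) := by
      rw [indexMultiset, indexMultiset, List.ofFn_congr hk.symm]
    rw [h4, hα]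
  -- The pairing with the right-hand side, summed up.
  have hleft : ∫ ω, Φ.val hW ω * (∑ ℓ : Fin (k + 1), ((-1 : ℝ) ^ (ℓ : ℕ) * (k.choose ℓ : ℝ)) •
        ∫ x, expansionTerm hW F u ℓ x ∂(cubeMeasure T ℓ) : Lp ℝ 2 P) ω ∂P
      = ∑ ℓ : Fin (k + 1), ((-1 : ℝ) ^ (ℓ : ℕ) * (k.choose ℓ : ℝ)) *
        ∑ i : Fin (k - ℓ) → Fin n, ∑ j : Fin ℓ → Fin n,
          α (indexMultiset i + indexMultiset j) * E i j := by
    have h1 := inner_toLp (Φ.memLp_val hW) (Lp.memLp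
      (∑ ℓ : Fin (k + 1), ((-1 : ℝ) ^ (ℓ : ℕ) * (k.choose ℓ : ℝ)) •
        ∫ x, expansionTerm hW F u ℓ x ∂(cubeMeasure T ℓ) : Lp ℝ 2 P))
    rw [Lp.toLp_coeFn] at h1
    rw [← h1, inner_sum]
    refine Finset.sum_congr rfl fun ℓ _ => ?_
    rw [real_inner_smul_right, ← integral_inner (integrable_expansionTerm hT hW hgen hF hu ℓ),
      hterm ℓ]
  -- The pairing of `F u` with the derivative of `Φ`.
  have hright : pairing hW (fun ω x => F.val hW ω * u x) Φ
      = ∫ ω, ∑ i : Fin k → Fin n, α (indexMultiset i) * (partialDeriv f i (V ω) * g (V ω)) ∂P := by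
    have h1 : ∀ z : Ω × (Fin k → Time T), F.val hW z.1 * u z.2 * Φ.deriv hW k z.1 z.2
        = ∑ i : Fin k → Fin n, (partialDeriv f i (V z.1) * g (V z.1))
          * (u z.2 * ∏ p, h (i p) (z.2 p)) := by
      intro z
      rw [← e3, ← e2]
      change g (V z.1) * u z.2 * ∑ i : Fin k → Fin n, partialDeriv f i (V z.1)
        * ∏ p, h (i p) (z.2 p) = _
      rw [Finset.mul_sum]
      refine Finset.sum_congr rfl fun i _ => ?_
      ring
    have h2 : ∀ i : Fin k → Fin n, Integrable (fun ω => partialDeriv f i (V ω) * g (V ω)) P :=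
      fun i => (Φ'.memLp_top_comp_vec hW ((hf.partialDeriv i).mul hg)).integrable le_top
    have h3 : ∀ i : Fin k → Fin n, Integrable (fun x => u x * ∏ p, h (i p) (x p))
        (cubeMeasure T k) := fun i => hu.integrable_mul (hten i)
    rw [pairing]
    simp only [h1]
    rw [integral_finsetSum _ fun i _ => (h2 i).mul_prod (h3 i),
      integral_finsetSum _ fun i _ => (h2 i).const_mul _]
    refine Finset.sum_congr rfl fun i _ => ?_
    rw [integral_prod_mul (fun ω => partialDeriv f i (V ω) * g (V ω))
      (fun x => u x * ∏ p, h (i p) (x p)), integral_const_mul, hα, mul_comm]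
  rw [hleft, hright]
  simp only [sum_partialDeriv_mul_eq hg.1 _ k α hf.1]
  have hXi : ∀ m l, Integrable (fun ω => leibnizTerm α f g m l (V ω)) P := fun m l =>
    integrable_finsetSum _ fun i _ => integrable_finsetSum _ fun j _ => (hEi i j).const_mul _
  have hX : ∀ m l, ∫ ω, leibnizTerm α f g m l (V ω) ∂P
      = ∑ i : Fin m → Fin n, ∑ j : Fin l → Fin n,
        α (indexMultiset i + indexMultiset j) * E i j := by
    intro m l
    unfold leibnizTerm
    rw [integral_finsetSum _ fun i _ => integrable_finsetSum _ fun j _ => (hEi i j).const_mul _]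
    refine Finset.sum_congr rfl fun i _ => ?_
    rw [integral_finsetSum _ fun j _ => (hEi i j).const_mul _]
    refine Finset.sum_congr rfl fun j _ => ?_
    rw [integral_const_mul]
  rw [integral_finsetSum _ fun p _ => ((hXi p.2 p.1).const_mul _).const_mul _]
  simp only [integral_const_mul, hX]
  rw [Finset.Nat.sum_antidiagonal_eq_sum_range_succ (fun l m => (k.choose l : ℝ) * ((-1) ^ l
    * ∑ i : Fin m → Fin n, ∑ j : Fin l → Fin n, α (indexMultiset i + indexMultiset j) * E i j)) k,
    Finset.sum_range]
  refine Finset.sum_congr rfl fun ℓ _ => ?_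
  ring

end Malliavin

theorem lemmaA3 {Ω : Type*} [MeasurableSpace Ω] (P : Measure Ω) [IsProbabilityMeasure P]
    (T : ℝ) (hT : 0 < T) (W : Malliavin.Time T → Ω → ℝ) (hW : Malliavin.IsWiener T W P)
    (hgen : Malliavin.IsGeneratedBy W P)
    (k : ℕ) (F : Malliavin.SmoothVar T) (hF : ∀ i, Continuous (F.h i))
    (u : (Fin k → Malliavin.Time T) → ℝ) (hu : MemLp u 2 (Malliavin.cubeMeasure T k))
    (hsymm : ∀ σ : Equiv.Perm (Fin k),
      ∀ᵐ x ∂(Malliavin.cubeMeasure T k), u (fun i => x (σ i)) = u x) :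
    Malliavin.MemDomDivergence hW (fun ω x => F.val hW ω * u x) ∧
    (∀ ℓ : Fin (k + 1),
      (∀ᵐ x ∂(Malliavin.cubeMeasure T ℓ),
        Malliavin.MemDomDivergence hW (fun _ : Ω => Malliavin.sectionAt u ℓ x)) ∧
      Integrable (Malliavin.expansionTerm hW F u ℓ) (Malliavin.cubeMeasure T ℓ)) ∧
    Malliavin.divergence hW (fun ω x => F.val hW ω * u x) =
      ∑ ℓ : Fin (k + 1), ((-1 : ℝ) ^ (ℓ : ℕ) * (k.choose ℓ : ℝ)) •
        ∫ x, Malliavin.expansionTerm hW F u ℓ x ∂(Malliavin.cubeMeasure T ℓ) := by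
  have hdiv := Malliavin.isDivergence_sum_expansionTerm hT hW hgen hF hu hsymm
  have hmem : MemLp (fun z : Ω × (Fin k → Malliavin.Time T) => F.val hW z.1 * u z.2) 2
      (P.prod (Malliavin.cubeMeasure T k)) :=
    MemLp.mul' (Malliavin.memLp_prod_of_memLp hu)
      ((F.memLp_top_comp_vec hW F.smooth).comp_fst (Malliavin.cubeMeasure T k))
  have hdom := hdiv.memDomDivergence hmem
  refine ⟨hdom, fun ℓ => ⟨?_, Malliavin.integrable_expansionTerm hT hW hgen hF hu ℓ⟩,
    hdiv.divergence_eq hT hgen hdom⟩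
  filter_upwards [(Malliavin.exists_integrable_divergence_section hT hW hgen hu ℓ).2] with x hx
  exact hx.2.1
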